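/- Let $G$ and $K$ be compact Lie groups acting smoothly, isometrically and with cohomogeneity one (the orbits of largest dimension have codimension one) on connected Riemannian manifolds $M$ and $N$, respectively. For $X$ in the Lie algebra let $X^\ast$ be the action field, $X^\ast_{|p}=\frac{d}{ds}\big|_{s=0}\exp(sX)\cdot p$. Let $\gamma:\mathbb R\to M$ and $\hat\gamma:\mathbb R\to N$ be unit-speed normal geodesics, i.e. geodesics that pass through all orbits perpendicularly. Call $s$ a regular parameter of $\gamma$ (of $\hat\gamma$) if $\gamma(s)$ (resp. $\hat\gamma(s)$) lies on a principal orbit, and let $H\subset G$ and $\hat H\subset K$ be the common isotropy groups of the points at regular parameters of $\gamma$ and of $\hat\gamma$. Let $A:G\to K$ be a homomorphism of Lie groups, $J\subset\mathbb R$ an open set of regular parameters of $\gamma$ (for instance the interior of $M/G$, $J=(0,L)$ if $M/G=[0,L]$ and $J=(0,\infty)$ if $M/G=[0,\infty)$), $r:J\to\mathbb R$ a smooth function, and $\psi:M\to N$ a map, smooth near $G\cdot\gamma(J)$, with $$\psi(g\cdot\gamma(s))=A(g)\cdot\hat\gamma(r(s))\qquad (g\in G,\ s\in J).$$ Let $\tau=\sum_\mu\bigl(\nabla_{e_\mu}(d\psi\,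 e_\mu)-d\psi\,\nabla_{e_\mu}e_\mu\bigr)$ be its tension field ($(e_\mu)$ a local orthonormal frame of $M$), and $\tau^{\mathrm{nor}}_{|\gamma(t)}=\langle\tau_{|\gamma(t)},\dot{\hat\gamma}(r(t))\rangle$ its normal component. Fix biinvariant metrics $Q$ on $G$ and $\hat Q$ on $K$, and let $\mathfrak n\subset\mathfrak g$ and $\hat{\mathfrak n}\subset\mathfrak k$ be the orthogonal complements of the Lie algebras of $H$ and $\hat H$. For $s\in\mathbb R$ the metric endomorphisms $P_s:\mathfrak n\to\mathfrak n$ and $\hat P_s:\hat{\mathfrak n}\to\hat{\mathfrak n}$ are defined by $$Q(X,P_sY)=\langle X^\ast,Y^\ast\rangle_{|\gamma(s)},\qquad \hat Q(X,\hat P_sY)=\langle X^\ast,Y^\ast\rangle_{|\hat\gamma(s)}.$$ Let $t\in J$ be such that $\hat\gamma(t)$ lies on a principal orbit. Let $E_1,\dots,E_n\in\mathfrak g$ be such that $E^\ast_{1|\gamma(t)},\dots,E^\ast_{n|\gamma(t)}$ form an orthonormal basis of $T_{\gamma(t)}(G\cdot\gamma(t))$, and let $F_1,\dots,F_m\in\hat{\mathfrak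 n}$ be such that $f_i=F^\ast_{i|\hat\gamma(t)}$, $i=1,\dots,m$, form an orthonormal basis of $T_{\hat\gamma(t)}(K\cdot\hat\gamma(t))$. Then $$\tau^{\mathrm{nor}}_{|\gamma(t)}=\ddot r(t)+\tfrac12\,\dot r(t)\operatorname{Tr}\bigl(P_t^{-1}\dot P_t\bigr)-\tfrac12\sum_{\mu=1}^n\sum_{i,j=1}^m c_{\mu,i}\,c_{\mu,j}\,P_{i,j},$$ where $c_{\mu,i}=\langle(dA_eE_\mu)^\ast,f_i\rangle_{|\hat\gamma(t)}$ and $P_{i,j}$ is the $(i,j)$-entry of the matrix of the endomorphism $\hat P_t^{-1}(\dot{\hat P})_{r(t)}$ of $\hat{\mathfrak n}$ with respect to the basis $F_1,\dots,F_m$; here $(\dot{\hat P})_{r(t)}$ is the derivative of $s\mapsto\hat P_s$ at $s=r(t)$. -/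

import Mathlib

open Bundle Manifold
open scoped ContDiff Topology

noncomputable section

namespace CohomOne

section Riemannian

variable {E : Type*} [NormedAddCommGroup E] [NormedSpace ℝ E] [FiniteDimensional ℝ E]
  {M : Type*} [TopologicalSpace M] [ChartedSpace E M] [IsManifold 𝓘(ℝ, E) ∞ M]

instance instFiniteDimensionalTangentSpace (p : M) :
    FiniteDimensional ℝ (TangentSpace 𝓘(ℝ, E) p) :=
  inferInstanceAs (FiniteDimensional ℝ E)

/-- The identification of the tangent spaces at two points that are equal. -/
def tangentCast {p q : M} (h : p = q) : TangentSpace 𝓘(ℝ, E) p →L[ℝ] TangentSpace 𝓘(ℝ, E) q :=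
  h ▸ ContinuousLinearMap.id ℝ (TangentSpace 𝓘(ℝ, E) p)

variable (E) in
/-- The velocity vector of a curve. -/
def velocity (c : ℝ → M) (t : ℝ) : TangentSpace 𝓘(ℝ, E) (c t) :=
  mfderiv 𝓘(ℝ, ℝ) 𝓘(ℝ, E) c t (1 : ℝ)

section Connection

variable [RiemannianBundle (fun p : M ↦ TangentSpace 𝓘(ℝ, E) p)]

/-- The derivative at `p` in direction `u` of the metric coefficient `⟨v̂, ŵ⟩`, where `v̂` and `ŵ`
are the extensions of `v` and `w` with constant components in the chart at `p`. -/
def metricDeriv (p : M) (u v w : TangentSpace 𝓘(ℝ, E) p) : ℝ :=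
  mvfderiv 𝓘(ℝ, E)
    (fun q : M ↦ (inner ℝ (FiberBundle.extend E v q : TangentSpace 𝓘(ℝ, E) q)
      (FiberBundle.extend E w q : TangentSpace 𝓘(ℝ, E) q) : ℝ)) p u

/-- The Christoffel symbol at `p` of the Levi-Civita connection in the chart at `p`, that is
`∇_v ŵ` for the extension `ŵ` of `w` with constant components in that chart. It is given by the
Koszul formula, in which the brackets of these extensions vanish:
`2 ⟨Γ(v, w), z⟩ = v⟨ŵ, ẑ⟩ + w⟨v̂, ẑ⟩ - z⟨v̂, ŵ⟩`. -/
def christoffel (p : M) (v w : TangentSpace 𝓘(ℝ, E) p) : TangentSpace 𝓘(ℝ, E) p :=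
  ∑ k, (1 / 2 * (metricDeriv p v w (stdOrthonormalBasis ℝ (TangentSpace 𝓘(ℝ, E) p) k)
        + metricDeriv p w v (stdOrthonormalBasis ℝ (TangentSpace 𝓘(ℝ, E) p) k)
        - metricDeriv p (stdOrthonormalBasis ℝ (TangentSpace 𝓘(ℝ, E) p) k) v w)) •
      stdOrthonormalBasis ℝ (TangentSpace 𝓘(ℝ, E) p) k

end Connection

variable {E' : Type*} [NormedAddCommGroup E'] [NormedSpace ℝ E'] [FiniteDimensional ℝ E']
  {N : Type*} [TopologicalSpace N] [ChartedSpace E' N] [IsManifold 𝓘(ℝ, E') ∞ N]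
  [RiemannianBundle (fun p : N ↦ TangentSpace 𝓘(ℝ, E') p)]

/-- The pull-back of the Levi-Civita connection of `N` along `f : M → N`: the covariant derivative
at `p` in direction `v` of a section `W` of `f⁻¹ TN`, computed in the chart of `N` at `f p`
(derivative of the components of `W` plus Christoffel term). -/
def covAlong (f : M → N) (W : ∀ q : M, TangentSpace 𝓘(ℝ, E') (f q)) (p : M)
    (v : TangentSpace 𝓘(ℝ, E) p) : TangentSpace 𝓘(ℝ, E') (f p) :=
  (trivializationAt E' (TangentSpace 𝓘(ℝ, E')) (f p)).symmL ℝ (f p)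
      (mvfderiv 𝓘(ℝ, E) (fun q : M ↦
        (trivializationAt E' (TangentSpace 𝓘(ℝ, E')) (f p)).continuousLinearMapAt ℝ (f q) (W q))
        p v)
    + christoffel (f p) (mfderiv 𝓘(ℝ, E) 𝓘(ℝ, E') f p v) (W p)

/-- A smooth curve `c` with `∇_{d/dt} c' = 0`. -/
structure IsGeodesic (c : ℝ → N) : Prop where
  smooth : ContMDiff 𝓘(ℝ, ℝ) 𝓘(ℝ, E') ∞ c
  acceleration_eq_zero : ∀ t : ℝ,
    covAlong (E := ℝ) (E' := E') (M := ℝ) c (velocity E' c) t (1 : ℝ) = 0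

variable [RiemannianBundle (fun p : M ↦ TangentSpace 𝓘(ℝ, E) p)]

/-- The Hessian `∇dψ(v, w) = ∇_v (dψ ŵ) - dψ (∇_v ŵ)` of `ψ`, where the vector field `ŵ` extends
`w` to a neighbourhood of `p`. -/
def hessian (ψ : M → N) (p : M) (v w : TangentSpace 𝓘(ℝ, E) p) : TangentSpace 𝓘(ℝ, E') (ψ p) :=
  covAlong ψ (fun q ↦ mfderiv 𝓘(ℝ, E) 𝓘(ℝ, E') ψ q (FiberBundle.extend E w q)) p v
    - mfderiv 𝓘(ℝ, E) 𝓘(ℝ, E') ψ p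
        (covAlong (fun q : M ↦ q) (fun q ↦ FiberBundle.extend E w q) p v)

variable (E E') in
/-- The tension field `τ = ∑ᵢ (∇_{eᵢ} (dψ eᵢ) - dψ (∇_{eᵢ} eᵢ))` of `ψ`, for an orthonormal basis
`eᵢ` of the tangent space. -/
def tension (ψ : M → N) (p : M) : TangentSpace 𝓘(ℝ, E') (ψ p) :=
  ∑ i, hessian ψ p (stdOrthonormalBasis ℝ (TangentSpace 𝓘(ℝ, E) p) i)
    (stdOrthonormalBasis ℝ (TangentSpace 𝓘(ℝ, E) p) i)

end Riemannian

section LieGroup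

variable {EG : Type*} [NormedAddCommGroup EG] [NormedSpace ℝ EG] [FiniteDimensional ℝ EG]
  {G : Type*} [TopologicalSpace G] [ChartedSpace EG G] [Group G] [LieGroup 𝓘(ℝ, EG) ∞ G]

/-- The differential at the identity of a homomorphism of Lie groups. -/
def lieMap {EK : Type*} [NormedAddCommGroup EK] [NormedSpace ℝ EK]
    {K : Type*} [TopologicalSpace K] [ChartedSpace EK K] [Group K] [LieGroup 𝓘(ℝ, EK) ∞ K]
    (A : G →* K) : GroupLieAlgebra 𝓘(ℝ, EG) G →L[ℝ] GroupLieAlgebra 𝓘(ℝ, EK) K :=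
  (tangentCast (map_one A)).comp (mfderiv 𝓘(ℝ, EG) 𝓘(ℝ, EK) A 1)

/-- The adjoint representation: the differential at the identity of conjugation by `g`. -/
def adjoint (g : G) : GroupLieAlgebra 𝓘(ℝ, EG) G →L[ℝ] GroupLieAlgebra 𝓘(ℝ, EG) G :=
  lieMap (MulAut.conj g).toMonoidHom

variable (EG G) in
/-- A biinvariant Riemannian metric on `G`, given by its value at the identity: an inner product on
the Lie algebra that is invariant under the adjoint representation. -/
structure BiinvariantMetric where
  form : LinearMap.BilinForm ℝ (GroupLieAlgebra 𝓘(ℝ, EG) G)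
  symm : ∀ X Y, form X Y = form Y X
  pos : ∀ X, X ≠ 0 → 0 < form X X
  adjoint_invariant : ∀ (g : G) (X Y), form (adjoint g X) (adjoint g Y) = form X Y

/-- The Lie algebra of a closed subgroup `H`: the velocities at the identity of the curves
in `H` that pass through the identity at time `0`. -/
def lieAlgebraOf (H : Subgroup G) : Set (GroupLieAlgebra 𝓘(ℝ, EG) G) :=
  {X | ∃ (c : ℝ → G) (h : c 0 = 1), (∀ᶠ s in 𝓝 (0 : ℝ), c s ∈ H) ∧
    MDifferentiableAt 𝓘(ℝ, ℝ) 𝓘(ℝ, EG) c 0 ∧ tangentCast h (velocity EG c 0) = X}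

/-- The orthogonal complement `𝔫` of the Lie algebra of `H` with respect to `Q`. -/
def complement (Q : BiinvariantMetric EG G) (H : Subgroup G) :
    Submodule ℝ (GroupLieAlgebra 𝓘(ℝ, EG) G) where
  carrier := {Y | ∀ X ∈ lieAlgebraOf H, Q.form X Y = 0}
  add_mem' hY hZ X hX := by rw [map_add, hY X hX, hZ X hX, add_zero]
  zero_mem' X _ := map_zero _
  smul_mem' a Y hY X hX := by rw [map_smul, hY X hX, smul_zero]

end LieGroup

section Action

variable {EG : Type*} [NormedAddCommGroup EG] [NormedSpace ℝ EG] [FiniteDimensional ℝ EG]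
  {G : Type*} [TopologicalSpace G] [ChartedSpace EG G] [Group G] [LieGroup 𝓘(ℝ, EG) ∞ G]
  {E : Type*} [NormedAddCommGroup E] [NormedSpace ℝ E] [FiniteDimensional ℝ E]
  {M : Type*} [TopologicalSpace M] [ChartedSpace E M] [IsManifold 𝓘(ℝ, E) ∞ M]
  [MulAction G M]

variable (EG E) in
/-- The action field `X ↦ X*_p = d/ds|₀ exp(sX) • p`, which is the differential at the identity of
the orbit map `g ↦ g • p`. -/
def actionField (p : M) : GroupLieAlgebra 𝓘(ℝ, EG) G →L[ℝ] TangentSpace 𝓘(ℝ, E) p :=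
  (tangentCast (one_smul G p)).comp (mfderiv 𝓘(ℝ, EG) 𝓘(ℝ, E) (fun g : G ↦ g • p) 1)

variable (EG G E) in
/-- The tangent space at `p` of the orbit `G • p`. -/
def orbitTangent (p : M) : Submodule ℝ (TangentSpace 𝓘(ℝ, E) p) :=
  LinearMap.range (actionField EG (G := G) E p).toLinearMap

variable (G) in
/-- The orbit of `p` is principal: its isotropy group is conjugate to a subgroup of every isotropy
group of the action. -/
def IsPrincipal (p : M) : Prop :=
  ∀ q : M, ∃ g : G, MulAction.stabilizer G (g • p) ≤ MulAction.stabilizer G q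

variable [RiemannianBundle (fun p : M ↦ TangentSpace 𝓘(ℝ, E) p)]

variable (EG G E M) in
/-- A smooth isometric action of cohomogeneity one: the lowest codimension of an orbit is one. -/
structure IsCohomogeneityOne : Prop where
  smooth : ContMDiffSMul 𝓘(ℝ, EG) 𝓘(ℝ, E) ∞ G M
  isometric : ∀ (g : G) (p : M) (v w : TangentSpace 𝓘(ℝ, E) p),
    inner ℝ (mfderiv 𝓘(ℝ, E) 𝓘(ℝ, E) (fun q : M ↦ g • q) p v)
      (mfderiv 𝓘(ℝ, E) 𝓘(ℝ, E) (fun q : M ↦ g • q) p w) = inner ℝ v w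
  codim_pos : ∀ p : M,
    Module.finrank ℝ (orbitTangent EG G E p) + 1
      ≤ Module.finrank ℝ E
  exists_codim_one : ∃ p : M,
    Module.finrank ℝ (orbitTangent EG G E p) + 1
      = Module.finrank ℝ E

variable (EG G E) in
/-- A unit-speed geodesic that passes through all orbits perpendicularly. -/
structure IsNormalGeodesic (γ : ℝ → M) : Prop where
  geodesic : IsGeodesic (E' := E) γ
  unit_speed : ∀ t, ‖velocity E γ t‖ = 1
  perpendicular : ∀ t, ∀ v ∈ orbitTangent EG G E (γ t),
    inner ℝ (velocity E γ t) v = 0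
  meets_orbits : ∀ p : M, ∃ (g : G) (t : ℝ), g • γ t = p

variable (E) in
/-- The bilinear form `(X, Y) ↦ ⟨X*, Y*⟩_p` on a subspace of the Lie algebra. -/
def actionForm (n : Submodule ℝ (GroupLieAlgebra 𝓘(ℝ, EG) G)) (p : M) :
    LinearMap.BilinForm ℝ n :=
  (innerₗ (TangentSpace 𝓘(ℝ, E) p)).compl₁₂
    ((actionField EG E p).toLinearMap ∘ₗ n.subtype)
    ((actionField EG E p).toLinearMap ∘ₗ n.subtype)

theorem restrict_nondegenerate (Q : BiinvariantMetric EG G)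
    (n : Submodule ℝ (GroupLieAlgebra 𝓘(ℝ, EG) G)) : (Q.form.restrict n).Nondegenerate := by
  have key : ∀ X : n, Q.form X X = 0 → X = 0 := by
    intro X hX
    by_contra h
    exact (Q.pos X (fun h0 ↦ h (Subtype.ext h0))).ne' hX
  exact ⟨fun X hX ↦ key X (hX X), fun X hX ↦ key X (hX X)⟩

variable (E) in
/-- The metric endomorphism `P_t` of `𝔫`, defined by `Q(X, P_t Y) = ⟨X*, Y*⟩_{γ(t)}`. -/
def metricEndo (Q : BiinvariantMetric EG G) (n : Submodule ℝ (GroupLieAlgebra 𝓘(ℝ, EG) G))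
    (γ : ℝ → M) (t : ℝ) : Module.End ℝ n :=
  (actionForm E n (γ t)).symmCompOfNondegenerate (Q.form.restrict n) (restrict_nondegenerate Q n)

theorem metricEndo_spec (Q : BiinvariantMetric EG G)
    (n : Submodule ℝ (GroupLieAlgebra 𝓘(ℝ, EG) G)) (γ : ℝ → M) (t : ℝ) (X Y : n) :
    Q.form X (metricEndo E Q n γ t Y) =
      inner ℝ (actionField EG E (γ t) (X : GroupLieAlgebra 𝓘(ℝ, EG) G))
        (actionField EG E (γ t) (Y : GroupLieAlgebra 𝓘(ℝ, EG) G)) := by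
  rw [Q.symm, real_inner_comm]
  exact (actionForm E n (γ t)).symmCompOfNondegenerate_left_apply
    (restrict_nondegenerate Q n) X Y

end Action

/-- The derivative of a curve of endomorphisms of a finite-dimensional vector space, taken
entrywise in a basis. -/
def endoDeriv {V : Type*} [AddCommGroup V] [Module ℝ V] [FiniteDimensional ℝ V]
    (P : ℝ → Module.End ℝ V) (t : ℝ) : Module.End ℝ V :=
  Matrix.toLin (Module.finBasis ℝ V) (Module.finBasis ℝ V) (Matrix.of fun i j ↦
    deriv (fun s ↦ LinearMap.toMatrix (Module.finBasis ℝ V) (Module.finBasis ℝ V) (P s) i j) t)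

end CohomOne

end

/-! The vector `γ'(t)` and the action fields `E_μ*` form an orthonormal basis of the tangent space
at `γ(t)`. The trace of the Hessian `∇dψ` does not depend on the basis, so the tension field is
`∇dψ(γ', γ') + ∑ ∇dψ(E_μ*, E_μ*)`. Each term is read off a curve by `∇(ψ ∘ x)' = ∇dψ(x', x') +
dψ(∇x')`, with `∇` the covariant derivative along the curve (`acc_comp`).

For `x = γ` one has `ψ ∘ γ = δ ∘ r` with `γ` and `δ` geodesics, and the normal part is `r''`
(`met_hess_vel`). For a curve `x(σ) = c(σ) • γ(t)` with `c'(0) = X`, the image is `A(c(σ)) •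
δ(r(t))`, again a curve in an orbit. The first variation formula for `(σ, υ) ↦ c(σ) • γ(υ)`, whose
two partial velocities are perpendicular, gives the normal part `-½ d/ds |X*|²` of the acceleration
of `x` (`met_acc_smul`). The same holds in `N`, with `dA X` in place of `X`. As `dψ` respects the
splitting into normal and tangential parts and multiplies the normal part by `r'`, the normal part
of `∇dψ(X*, X*)` follows (`met_hess_act`, `met_tension`).

It remains to express these derivatives by metric endomorphisms. In a basis of `𝔫` whose action
fields are orthonormal at time `t`, the matrix of `P_t⁻¹ P'_r` is the derivative at `r` of the Gram
matrix of the action fields. This needs two facts: the Lie algebra of one regular isotropy group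
acts trivially along all of `γ`, and `𝔫` acts injectively at every regular point. Both come from
`mul_self_smul`: an isotropy `g` at a regular point preserves the normal line, so it sends `γ'` to
`±γ'`. Hence `g²` fixes `γ'`, and by uniqueness of geodesics it fixes all of `γ`. On velocities at
the identity, squaring is only doubling. -/

noncomputable section
set_option maxSynthPendingDepth 3
set_option linter.unusedSectionVars false
namespace CohomOne

/-! ### Differentials of charts and the metric tensor in coordinates. -/

section Vector
variable {E : Type*} [NormedAddCommGroup E] [NormedSpace ℝ E]

theorem hasFDerivAt_apply_apply {g : E → E →L[ℝ] E →L[ℝ] ℝ} {g' : E →L[ℝ] E →L[ℝ] E →L[ℝ] ℝ}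
    {y : E} (hg : HasFDerivAt g g' y) (v w : E) :
    HasFDerivAt (fun z ↦ g z v w) ((g'.flip v).flip w) y := by
  refine ((hg.clm_apply (hasFDerivAt_const v y)).clm_apply (hasFDerivAt_const w y)).congr_fderiv ?_
  ext z
  simp

end Vector

section Chart
variable {E : Type*} [NormedAddCommGroup E] [NormedSpace ℝ E] [FiniteDimensional ℝ E]
  {M : Type*} [TopologicalSpace M] [ChartedSpace E M] [IsManifold 𝓘(ℝ, E) ∞ M]

theorem tangentCast_apply {p q : M} (h : p = q) (v : E) :
    (tangentCast (E := E) h (v : TangentSpace 𝓘(ℝ, E) p) : E) = v := by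
  subst h; rfl

/-- The differential of the chart at `p`. -/
def dchart (p q : M) : E →L[ℝ] E := mfderiv 𝓘(ℝ, E) 𝓘(ℝ, E) (extChartAt 𝓘(ℝ, E) p) q

/-- The differential of the inverse of the chart at `p`. -/
def dchartSymm (p q : M) : E →L[ℝ] E :=
  (trivializationAt E (TangentSpace 𝓘(ℝ, E)) p).symmL ℝ q

theorem dchart_self (p : M) : dchart (E := E) p p = ContinuousLinearMap.id ℝ E :=
  mfderiv_extChartAt_self

theorem continuousLinearMapAt_eq_dchart {p q : M} (hq : q ∈ (chartAt E p).source) (v : E) :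
    (trivializationAt E (TangentSpace 𝓘(ℝ, E)) p).continuousLinearMapAt ℝ q
      (show TangentSpace 𝓘(ℝ, E) q from v) = dchart p q v := by
  have := TangentBundle.continuousLinearMapAt_trivializationAt (I := 𝓘(ℝ, E)) hq
  exact DFunLike.congr_fun this v

theorem dchart_dchartSymm {p q : M} (hq : q ∈ (chartAt E p).source) (v : E) :
    dchart p q (dchartSymm p q v) = v := by
  rw [← continuousLinearMapAt_eq_dchart hq]
  exact Trivialization.continuousLinearMapAt_symmL (R := ℝ)
    (trivializationAt E (TangentSpace 𝓘(ℝ, E)) p) hq v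

theorem dchartSymm_dchart {p q : M} (hq : q ∈ (chartAt E p).source) (v : E) :
    dchartSymm p q (dchart p q v) = v := by
  rw [← continuousLinearMapAt_eq_dchart hq]
  exact Trivialization.symmL_continuousLinearMapAt (R := ℝ)
    (trivializationAt E (TangentSpace 𝓘(ℝ, E)) p) hq (show TangentSpace 𝓘(ℝ, E) q from v)

theorem dchartSymm_self (p : M) (v : E) : dchartSymm p p v = v := by
  conv_lhs => rw [show v = dchart p p v by rw [dchart_self]; rfl]
  exact dchartSymm_dchart (mem_chart_source E p) v

/-- The extensions used in `christoffel` and `hessian` have constant components in the chart at `p`,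
so covariant derivatives of them reduce to Christoffel terms. -/
theorem extend_eq_dchartSymm {p q : M} (hq : q ∈ (chartAt E p).source) (v : E) :
    (FiberBundle.extend E (show TangentSpace 𝓘(ℝ, E) p from v) q : TangentSpace 𝓘(ℝ, E) q) =
      dchartSymm p q v := by
  have h : ((trivializationAt E (TangentSpace 𝓘(ℝ, E)) p)
      ⟨p, show TangentSpace 𝓘(ℝ, E) p from v⟩).2 = v := by
    rw [← Trivialization.continuousLinearMapAt_apply_of_mem (R := ℝ) _ (mem_chart_source E p),
      continuousLinearMapAt_eq_dchart (mem_chart_source E p), dchart_self]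
    rfl
  unfold FiberBundle.extend
  simp only [h]
  exact (Trivialization.symmL_apply (R := ℝ) _ hq v).symm

variable [RiemannianBundle (fun p : M ↦ TangentSpace 𝓘(ℝ, E) p)]

/-- The inner product of the tangent space at `p`, as a bilinear form on the model space. -/
def met (p : M) : E →L[ℝ] E →L[ℝ] ℝ := innerSL ℝ (E := TangentSpace 𝓘(ℝ, E) p)

theorem inner_eq_met (p : M) (v w : TangentSpace 𝓘(ℝ, E) p) :
    inner ℝ v w = met (E := E) p v w := rfl

theorem met_comm (p : M) (v w : E) : met p v w = met p w v :=
  real_inner_comm (F := TangentSpace 𝓘(ℝ, E) p) w v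

theorem met_self_eq_zero {p : M} {v : E} : met p v v = 0 ↔ v = 0 :=
  inner_self_eq_zero (𝕜 := ℝ) (E := TangentSpace 𝓘(ℝ, E) p)

/-- The metric tensor in the chart at `p`, as a bilinear form on the model space that depends on a
point `y` of the chart. -/
def chartMetric (p : M) (y : E) : E →L[ℝ] E →L[ℝ] ℝ :=
  (met ((extChartAt 𝓘(ℝ, E) p).symm y)).bilinearComp
    (dchartSymm p ((extChartAt 𝓘(ℝ, E) p).symm y)) (dchartSymm p ((extChartAt 𝓘(ℝ, E) p).symm y))

theorem chartMetric_apply (p : M) (y v w : E) : chartMetric p y v w =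
    met ((extChartAt 𝓘(ℝ, E) p).symm y) (dchartSymm p ((extChartAt 𝓘(ℝ, E) p).symm y) v)
      (dchartSymm p ((extChartAt 𝓘(ℝ, E) p).symm y) w) := rfl

theorem chartMetric_comm (p : M) (y v w : E) : chartMetric p y v w = chartMetric p y w v := by
  rw [chartMetric_apply, chartMetric_apply, met_comm]

theorem met_eq_chartMetric {p q : M} (hq : q ∈ (chartAt E p).source) (v w : E) :
    met q v w = chartMetric p (extChartAt 𝓘(ℝ, E) p q) (dchart p q v) (dchart p q w) := by
  rw [chartMetric_apply, (extChartAt 𝓘(ℝ, E) p).left_inv (by simpa using hq),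
    dchartSymm_dchart hq, dchartSymm_dchart hq]

theorem inner_extend_eq {p q : M} (hq : q ∈ (chartAt E p).source) (v w : TangentSpace 𝓘(ℝ, E) p) :
    (inner ℝ (FiberBundle.extend E v q : TangentSpace 𝓘(ℝ, E) q)
      (FiberBundle.extend E w q : TangentSpace 𝓘(ℝ, E) q) : ℝ) =
    chartMetric p (extChartAt 𝓘(ℝ, E) p q) v w := by
  have h (u : E) : dchart (E := E) p q (FiberBundle.extend E (show TangentSpace 𝓘(ℝ, E) p from u) q) = u :=
    (congrArg _ (extend_eq_dchartSymm hq u)).trans (dchart_dchartSymm hq u)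
  have h2 := met_eq_chartMetric hq
    (show E from (FiberBundle.extend E v q : TangentSpace 𝓘(ℝ, E) q))
    (show E from (FiberBundle.extend E w q : TangentSpace 𝓘(ℝ, E) q))
  exact h2.trans (congrArg₂ (fun a b ↦ chartMetric p (extChartAt 𝓘(ℝ, E) p q) a b) (h v) (h w))

theorem chartMetric_self_eq_zero {p : M} {y : E} (hy : y ∈ (extChartAt 𝓘(ℝ, E) p).target) {v : E} :
    chartMetric p y v v = 0 ↔ v = 0 := by
  have hq : (extChartAt 𝓘(ℝ, E) p).symm y ∈ (chartAt E p).source := by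
    simpa using (extChartAt 𝓘(ℝ, E) p).map_target hy
  rw [chartMetric_apply, met_self_eq_zero]
  constructor
  · intro h
    rw [← dchart_dchartSymm hq v, h, map_zero]
  · rintro rfl
    exact map_zero _

variable [IsContMDiffRiemannianBundle 𝓘(ℝ, E) ∞ E (fun p : M ↦ TangentSpace 𝓘(ℝ, E) p)]

theorem contDiffOn_chartMetric (p : M) :
    ContDiffOn ℝ ∞ (chartMetric (E := E) p) (extChartAt 𝓘(ℝ, E) p).target := by
  rw [contDiffOn_clm_apply]
  intro v
  rw [contDiffOn_clm_apply]
  intro w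
  have key : ∀ u : TangentSpace 𝓘(ℝ, E) p, ContMDiffOn 𝓘(ℝ, E) (𝓘(ℝ, E).prod 𝓘(ℝ, E)) ∞
      (fun q : M ↦ (⟨q, FiberBundle.extend E u q⟩ : TangentBundle 𝓘(ℝ, E) M))
      (chartAt E p).source := by
    intro u q hq
    have h2 : ∀ x ∈ (chartAt E p).source,
      x ∈ (trivializationAt E (TangentSpace 𝓘(ℝ, E)) p).baseSet := fun _ hx ↦ hx
    refine ((Trivialization.contMDiffWithinAt_section _ (h2 q hq)).2 ?_)
    have : ContMDiffOn 𝓘(ℝ, E) 𝓘(ℝ, E) ∞ (fun _ : M ↦ (show E from u)) (chartAt E p).source :=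
      contMDiffOn_const
    refine (this.congr fun x hx ↦ ?_) q hq
    refine (Trivialization.continuousLinearMapAt_apply_of_mem (R := ℝ) _ (h2 x hx) _).symm.trans ?_
    exact (continuousLinearMapAt_eq_dchart hx _).trans
      ((congrArg _ (extend_eq_dchartSymm hx u)).trans (dchart_dchartSymm hx u))
  have h3 : ContMDiffOn 𝓘(ℝ, E) 𝓘(ℝ, ℝ) ∞ (fun q : M ↦
      inner ℝ (FiberBundle.extend E (show TangentSpace 𝓘(ℝ, E) p from v) q : TangentSpace 𝓘(ℝ, E) q)
        (FiberBundle.extend E (show TangentSpace 𝓘(ℝ, E) p from w) q : TangentSpace 𝓘(ℝ, E) q))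
      (chartAt E p).source :=
    ContMDiffOn.inner_bundle (key v) (key w)
  have h4 := h3.comp (contMDiffOn_extChartAt_symm p) (s := (extChartAt 𝓘(ℝ, E) p).target) (by
    intro y hy
    simpa using (extChartAt 𝓘(ℝ, E) p).map_target hy)
  rw [← contMDiffOn_iff_contDiffOn]
  refine h4.congr fun y hy ↦ ?_
  have h5 := inner_extend_eq (p := p) (q := (extChartAt 𝓘(ℝ, E) p).symm y)
    (by simpa using (extChartAt 𝓘(ℝ, E) p).map_target hy) v w
  rw [(extChartAt 𝓘(ℝ, E) p).right_inv hy] at h5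
  exact h5.symm

theorem contDiffAt_chartMetric {p : M} {y : E} (hy : y ∈ (extChartAt 𝓘(ℝ, E) p).target) :
    ContDiffAt ℝ ∞ (chartMetric (E := E) p) y :=
  (contDiffOn_chartMetric p).contDiffAt ((isOpen_extChartAt_target p).mem_nhds hy)

theorem metricDeriv_eq (p : M) (u v w : E) :
    metricDeriv (E := E) p u v w
      = fderiv ℝ (chartMetric p) (extChartAt 𝓘(ℝ, E) p p) u v w := by
  have hev : (fun q : M ↦ (inner ℝ
      (FiberBundle.extend E (show TangentSpace 𝓘(ℝ, E) p from v) q : TangentSpace 𝓘(ℝ, E) q)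
      (FiberBundle.extend E (show TangentSpace 𝓘(ℝ, E) p from w) q : TangentSpace 𝓘(ℝ, E) q) : ℝ))
      =ᶠ[𝓝 p] (fun y ↦ chartMetric p y v w) ∘ extChartAt 𝓘(ℝ, E) p := by
    filter_upwards [chart_source_mem_nhds E p] with q hq using inner_extend_eq hq v w
  have hd : HasFDerivAt (chartMetric (E := E) p) (fderiv ℝ (chartMetric p) (extChartAt 𝓘(ℝ, E) p p))
      (extChartAt 𝓘(ℝ, E) p p) :=
    ((contDiffAt_chartMetric (mem_extChartAt_target p)).differentiableAt (by simp)).hasFDerivAt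
  have h1 := hasFDerivAt_apply_apply hd v w
  have h2 := (h1.hasMFDerivAt).comp p
    (mdifferentiableAt_extChartAt (I := 𝓘(ℝ, E)) (mem_chart_source E p)).hasMFDerivAt
  have h3 := (h2.congr_of_eventuallyEq hev).mfderiv
  unfold metricDeriv mvfderiv
  rw [h3, mfderiv_extChartAt_self]
  rfl
end Chart

/-! ### Acceleration, Hessian and the second-order chain rule. -/

section Vector
variable {E : Type*} [NormedAddCommGroup E] [NormedSpace ℝ E]
  {F : Type*} [NormedAddCommGroup F] [NormedSpace ℝ F]

theorem deriv_deriv_comp {f : E → F} {x : ℝ → E} {t : ℝ} (hf : ContDiffAt ℝ 2 f (x t))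
    (hx : ContDiffAt ℝ 2 x t) :
    deriv (deriv (f ∘ x)) t
      = fderiv ℝ (fderiv ℝ f) (x t) (deriv x t) (deriv x t) + fderiv ℝ f (x t) (deriv (deriv x) t) := by
  have h1 : deriv (f ∘ x) =ᶠ[𝓝 t] fun s ↦ fderiv ℝ f (x s) (deriv x s) := by
    have hf' := hx.continuousAt.eventually (hf.eventually (by simp))
    filter_upwards [hf', hx.eventually (by simp)] with s hs hxs
    exact ((hs.differentiableAt (by simp)).hasFDerivAt.comp_hasDerivAt s
      (hxs.differentiableAt (by simp)).hasDerivAt).deriv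
  rw [h1.deriv_eq]
  have hf2 : DifferentiableAt ℝ (fderiv ℝ f) (x t) :=
    (hf.fderiv_right (m := 1) (by norm_num)).differentiableAt (by simp)
  have hx2 : DifferentiableAt ℝ (deriv x) t := by
    have := (hx.fderiv_right (m := 1) (by norm_num)).differentiableAt (by simp)
    exact (this.clm_apply (differentiableAt_const (1 : ℝ)))
  have := (hf2.hasFDerivAt.comp_hasDerivAt t (hx.differentiableAt (by simp)).hasDerivAt).clm_apply
    hx2.hasDerivAt
  exact this.deriv

end Vector

section Chart
variable {E : Type*} [NormedAddCommGroup E] [NormedSpace ℝ E] [FiniteDimensional ℝ E]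
  {M : Type*} [TopologicalSpace M] [ChartedSpace E M] [IsManifold 𝓘(ℝ, E) ∞ M]

variable (E) in
/-- The velocity of a curve, as a vector of the model space. -/
def vel (x : ℝ → M) (t : ℝ) : E := velocity E x t

theorem dchart_vel {p : M} {x : ℝ → M} {t : ℝ} (hp : x t ∈ (chartAt E p).source)
    (hx : MDifferentiableAt 𝓘(ℝ, ℝ) 𝓘(ℝ, E) x t) :
    dchart p (x t) (vel E x t) = deriv (extChartAt 𝓘(ℝ, E) p ∘ x) t := by
  have h := HasMFDerivAt.comp t
    (mdifferentiableAt_extChartAt (I := 𝓘(ℝ, E)) hp).hasMFDerivAt hx.hasMFDerivAt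
  rw [← fderiv_apply_one_eq_deriv, ← mfderiv_eq_fderiv]
  exact (DFunLike.congr_fun h.mfderiv (1 : ℝ)).symm

theorem contDiffAt_extChartAt_comp {p : M} {x : ℝ → M} {t : ℝ}
    (hp : x t ∈ (chartAt E p).source) (hx : ContMDiffAt 𝓘(ℝ, ℝ) 𝓘(ℝ, E) 2 x t) :
    ContDiffAt ℝ 2 (extChartAt 𝓘(ℝ, E) p ∘ x) t := by
  rw [← contMDiffAt_iff_contDiffAt]
  exact (contMDiffAt_extChartAt' (n := 2) hp).comp t hx

variable [RiemannianBundle (fun p : M ↦ TangentSpace 𝓘(ℝ, E) p)]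

theorem eq_of_met_eq {p : M} {v w : E} (h : ∀ z, met p v z = met p w z) : v = w := by
  have : met p (v - w) (v - w) = 0 := by
    rw [map_sub (met p) v w, sub_apply, h, sub_self]
  exact sub_eq_zero.1 (met_self_eq_zero.1 this)

/-- The covariant acceleration `∇_{d/dt} x'` of a curve `x`. -/
def acc (x : ℝ → M) (t : ℝ) : E :=
  covAlong (E := ℝ) (E' := E) (M := ℝ) x (velocity E x) t (1 : ℝ)

variable [IsContMDiffRiemannianBundle 𝓘(ℝ, E) ∞ E (fun p : M ↦ TangentSpace 𝓘(ℝ, E) p)]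

/-- The Christoffel symbol, as a vector of the model space. -/
def chr (p : M) (v w : E) : E := christoffel (E := E) p v w

/-- `christoffel` expands in an orthonormal basis the vector that represents the Koszul functional
`c`, so pairing it with `z` gives back `c z`. By nondegeneracy this formula determines the symbol,
which is how its bilinearity is obtained. -/
theorem met_chr (p : M) (v w z : E) :
    met p (chr p v w) z =
      1 / 2 * (fderiv ℝ (chartMetric p) (extChartAt 𝓘(ℝ, E) p p) v w z
        + fderiv ℝ (chartMetric p) (extChartAt 𝓘(ℝ, E) p p) w v z
        - fderiv ℝ (chartMetric p) (extChartAt 𝓘(ℝ, E) p p) z v w) := by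
  set D := fderiv ℝ (chartMetric p) (extChartAt 𝓘(ℝ, E) p p)
  let c : E →ₗ[ℝ] ℝ := (1 / 2 : ℝ) • ((D v w).toLinearMap + (D w v).toLinearMap
    - (((D.flip v).flip w)).toLinearMap)
  have hc (z : E) : c z = 1 / 2 * (D v w z + D w v z - D z v w) := by simp [c]
  let b := stdOrthonormalBasis ℝ (TangentSpace 𝓘(ℝ, E) p)
  let b' : Fin _ → E := fun k ↦ b k
  have h1 : chr p v w = ∑ k, c (b' k) • b' k := by
    have h (k) : c (b' k) = 1 / 2 * (metricDeriv (E := E) p v w (b k)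
        + metricDeriv (E := E) p w v (b k) - metricDeriv (E := E) p (b k) v w) := by
      rw [hc, ← metricDeriv_eq, ← metricDeriv_eq, ← metricDeriv_eq]
    simp only [h]
    rfl
  rw [← hc]
  have h2 : (∑ k, met p (b' k) z • b' k) = z := b.sum_repr' (show TangentSpace 𝓘(ℝ, E) p from z)
  conv_rhs => rw [← h2]
  rw [h1]
  simp only [map_sum, map_smul, sum_apply, smul_apply, smul_eq_mul, mul_comm]

variable (E) in
/-- The Christoffel symbol as a bilinear map. -/
def christoffelBilin (p : M) : E →ₗ[ℝ] E →ₗ[ℝ] E :=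
  LinearMap.mk₂ ℝ (fun v w ↦ chr p v w)
    (fun v v' w ↦ eq_of_met_eq (p := p) fun z ↦ by
      simp only [map_add, add_apply, met_chr]; ring)
    (fun a v w ↦ eq_of_met_eq (p := p) fun z ↦ by
      simp only [map_smul, smul_apply, met_chr, smul_eq_mul]; ring)
    (fun v w w' ↦ eq_of_met_eq (p := p) fun z ↦ by
      simp only [map_add, add_apply, met_chr]; ring)
    (fun a v w ↦ eq_of_met_eq (p := p) fun z ↦ by
      simp only [map_smul, smul_apply, met_chr, smul_eq_mul]; ring)

theorem christoffelBilin_apply (p : M) (v w : E) : christoffelBilin E p v w = chr p v w := rfl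

end Chart

section Map
variable {E : Type*} [NormedAddCommGroup E] [NormedSpace ℝ E] [FiniteDimensional ℝ E]
  {M : Type*} [TopologicalSpace M] [ChartedSpace E M] [IsManifold 𝓘(ℝ, E) ∞ M]
  {E' : Type*} [NormedAddCommGroup E'] [NormedSpace ℝ E'] [FiniteDimensional ℝ E']
  {N : Type*} [TopologicalSpace N] [ChartedSpace E' N] [IsManifold 𝓘(ℝ, E') ∞ N]

variable (E E') in
/-- The differential of a map, as a linear map of the model spaces. -/
def dmap (ψ : M → N) (p : M) : E →L[ℝ] E' := mfderiv 𝓘(ℝ, E) 𝓘(ℝ, E') ψ p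

variable (E E') in
/-- A map in the charts at `p` and at its value. -/
def chartRep (ψ : M → N) (p : M) : E → E' :=
  extChartAt 𝓘(ℝ, E') (ψ p) ∘ ψ ∘ (extChartAt 𝓘(ℝ, E) p).symm

theorem contDiffAt_chartRep {ψ : M → N} {p : M} {n : WithTop ℕ∞}
    (hψ : ContMDiffAt 𝓘(ℝ, E) 𝓘(ℝ, E') n ψ p) :
    ContDiffAt ℝ n (chartRep E E' ψ p) (extChartAt 𝓘(ℝ, E) p p) := by
  have := (contMDiffAt_iff.1 hψ).2
  simpa [chartRep, contDiffWithinAt_univ] using this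

theorem chartRep_comp_eventuallyEq (ψ : M → N) (p : M) :
    chartRep E E' ψ p ∘ extChartAt 𝓘(ℝ, E) p =ᶠ[𝓝 p] extChartAt 𝓘(ℝ, E') (ψ p) ∘ ψ := by
  filter_upwards [chart_source_mem_nhds E p] with q hq
  simp only [chartRep, Function.comp]
  rw [(extChartAt 𝓘(ℝ, E) p).left_inv (by simpa using hq)]

/-- Needed on a whole neighbourhood of `p`, since the Hessian differentiates this identity once
more. -/
theorem eventually_fderiv_chartRep {ψ : M → N} {p : M} 
    (hψ : ContMDiffAt 𝓘(ℝ, E) 𝓘(ℝ, E') 2 ψ p) :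
    ∀ᶠ q in 𝓝 p, ∀ w, fderiv ℝ (chartRep E E' ψ p) (extChartAt 𝓘(ℝ, E) p q) (dchart p q w) =
      dchart (ψ p) (ψ q) (dmap E E' ψ q w) := by
  have h1 := (continuousAt_extChartAt (I := 𝓘(ℝ, E)) p).eventually
    ((contDiffAt_chartRep hψ).eventually (by simp))
  filter_upwards [(chartRep_comp_eventuallyEq (E := E) (E' := E') ψ p).eventuallyEq_nhds, h1,
    (contMDiffAt_iff_contMDiffAt_nhds (by simp)).1 hψ, chart_source_mem_nhds E p,
    hψ.continuousAt.eventually (chart_source_mem_nhds E' (ψ p))] with q hq hq1 hq2 hq3 hq4 w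
  have hl := HasMFDerivAt.comp q (hq1.differentiableAt (by simp)).hasFDerivAt.hasMFDerivAt
    (mdifferentiableAt_extChartAt (I := 𝓘(ℝ, E)) hq3).hasMFDerivAt
  have hr := HasMFDerivAt.comp q (mdifferentiableAt_extChartAt (I := 𝓘(ℝ, E')) hq4).hasMFDerivAt
    (hq2.mdifferentiableAt (by simp)).hasMFDerivAt
  exact DFunLike.congr_fun (hasMFDerivAt_unique hl (hr.congr_of_eventuallyEq hq)) w

theorem dmap_eq_fderiv_chartRep {ψ : M → N} {p : M}
    (hψ : ContMDiffAt 𝓘(ℝ, E) 𝓘(ℝ, E') 2 ψ p) (w : E) :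
    dmap E E' ψ p w = fderiv ℝ (chartRep E E' ψ p) (extChartAt 𝓘(ℝ, E) p p) w := by
  have := (eventually_fderiv_chartRep hψ).self_of_nhds w
  rw [dchart_self, dchart_self] at this
  exact this.symm

theorem mvfderiv_apply_of_eventuallyEq {f : M → E'} {F : E → E'} {p : M}
    (hF : DifferentiableAt ℝ F (extChartAt 𝓘(ℝ, E) p p))
    (h : f =ᶠ[𝓝 p] F ∘ extChartAt 𝓘(ℝ, E) p) (v : E) :
    mvfderiv 𝓘(ℝ, E) f p v = fderiv ℝ F (extChartAt 𝓘(ℝ, E) p p) v := by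
  have h2 := HasMFDerivAt.comp p hF.hasFDerivAt.hasMFDerivAt
    (mdifferentiableAt_extChartAt (I := 𝓘(ℝ, E)) (mem_chart_source E p)).hasMFDerivAt
  have h3 := (h2.congr_of_eventuallyEq h).mfderiv
  unfold mvfderiv
  rw [h3, mfderiv_extChartAt_self]
  rfl

theorem dmap_comp {E'' : Type*} [NormedAddCommGroup E''] [NormedSpace ℝ E'']
    {N' : Type*} [TopologicalSpace N'] [ChartedSpace E'' N'] {ψ : M → N} {χ : N → N'} {p : M}
    (hχ : MDifferentiableAt 𝓘(ℝ, E') 𝓘(ℝ, E'') χ (ψ p))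
    (hψ : MDifferentiableAt 𝓘(ℝ, E) 𝓘(ℝ, E') ψ p) (v : E) :
    dmap E E'' (χ ∘ ψ) p v = dmap E' E'' χ (ψ p) (dmap E E' ψ p v) :=
  DFunLike.congr_fun (mfderiv_comp p hχ hψ) v

theorem vel_comp {ψ : M → N} {x : ℝ → M} {t : ℝ}
    (hψ : MDifferentiableAt 𝓘(ℝ, E) 𝓘(ℝ, E') ψ (x t))
    (hx : MDifferentiableAt 𝓘(ℝ, ℝ) 𝓘(ℝ, E) x t) :
    vel E' (ψ ∘ x) t = dmap E E' ψ (x t) (vel E x t) :=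
  DFunLike.congr_fun (mfderiv_comp t hψ hx) (1 : ℝ)

variable [RiemannianBundle (fun p : N ↦ TangentSpace 𝓘(ℝ, E') p)]
  [IsContMDiffRiemannianBundle 𝓘(ℝ, E') ∞ E' (fun p : N ↦ TangentSpace 𝓘(ℝ, E') p)]

/-- `F` is the section `W` written in the charts at `p` and `f p`. The differential of a chart at
its own centre is the identity, so no transition map remains. -/
theorem covAlong_eq {f : M → N} {W : ∀ q : M, TangentSpace 𝓘(ℝ, E') (f q)} {p : M} {F : E → E'}
    (hF : DifferentiableAt ℝ F (extChartAt 𝓘(ℝ, E) p p))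
    (h : ∀ᶠ q in 𝓝 p, f q ∈ (chartAt E' (f p)).source ∧
      dchart (E := E') (f p) (f q) (W q) = F (extChartAt 𝓘(ℝ, E) p q)) (v : E) :
    (covAlong (E := E) (E' := E') f W p v : E') = fderiv ℝ F (extChartAt 𝓘(ℝ, E) p p) v
      + chr (f p) (dmap E E' f p v) (W p) := by
  have hev : (fun q ↦ (trivializationAt E' (TangentSpace 𝓘(ℝ, E')) (f p)).continuousLinearMapAt ℝ
      (f q) (W q)) =ᶠ[𝓝 p] F ∘ extChartAt 𝓘(ℝ, E) p := by
    filter_upwards [h] with q hq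
    exact (continuousLinearMapAt_eq_dchart hq.1 _).trans hq.2
  rw [← mvfderiv_apply_of_eventuallyEq hF hev v]
  exact congrArg (fun u : E' ↦ u + chr (f p) (dmap E E' f p v) (W p)) (dchartSymm_self (f p) _)

theorem acc_eq {x : ℝ → N} {t : ℝ} (hx : ContMDiffAt 𝓘(ℝ, ℝ) 𝓘(ℝ, E') 2 x t) :
    (acc x t : E') = deriv (deriv (extChartAt 𝓘(ℝ, E') (x t) ∘ x)) t
      + chr (x t) (vel E' x t) (vel E' x t) := by
  have hd : ContDiffAt ℝ 2 (extChartAt 𝓘(ℝ, E') (x t) ∘ x) t :=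
    contDiffAt_extChartAt_comp (mem_chart_source E' (x t)) hx
  have h := covAlong_eq (E := ℝ) (M := ℝ) (f := x) (W := velocity E' x) (p := t)
    (F := deriv (extChartAt 𝓘(ℝ, E') (x t) ∘ x)) (by
      have := (hd.fderiv_right (m := 1) (by norm_num)).differentiableAt (by simp)
      exact this.clm_apply (differentiableAt_const (1 : ℝ))) (by
      filter_upwards [hx.continuousAt.eventually (chart_source_mem_nhds E' (x t)),
        (contMDiffAt_iff_contMDiffAt_nhds (by simp)).1 hx] with s hs hxs
      exact ⟨hs, dchart_vel hs (hxs.mdifferentiableAt (by simp))⟩) 1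
  simpa using! h

variable [RiemannianBundle (fun p : M ↦ TangentSpace 𝓘(ℝ, E) p)]
  [IsContMDiffRiemannianBundle 𝓘(ℝ, E) ∞ E (fun p : M ↦ TangentSpace 𝓘(ℝ, E) p)]

variable (E E') in
/-- The Hessian of a map, as a function of the model spaces. -/
def hess (ψ : M → N) (p : M) (v w : E) : E' := hessian (E := E) (E' := E') ψ p v w

/-- The extension of `w` has constant coordinates, so its image under `dψ` has the coordinates
`D(chartRep) w`. Differentiating gives the second derivative; the Christoffel terms come from target
and source. -/
theorem hess_eq {ψ : M → N} {p : M} (hψ : ContMDiffAt 𝓘(ℝ, E) 𝓘(ℝ, E') 2 ψ p) (v w : E) :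
    hess E E' ψ p v w = fderiv ℝ (fderiv ℝ (chartRep E E' ψ p)) (extChartAt 𝓘(ℝ, E) p p) v w
      + chr (ψ p) (dmap E E' ψ p v) (dmap E E' ψ p w) - dmap E E' ψ p (chr p v w) := by
  have hd : HasFDerivAt (fun y ↦ fderiv ℝ (chartRep E E' ψ p) y w)
      ((fderiv ℝ (fderiv ℝ (chartRep E E' ψ p)) (extChartAt 𝓘(ℝ, E) p p)).flip w)
      (extChartAt 𝓘(ℝ, E) p p) := by
    have := (((contDiffAt_chartRep hψ).fderiv_right (m := 1) (by norm_num)).differentiableAt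
      (by simp)).hasFDerivAt.clm_apply (hasFDerivAt_const w (extChartAt 𝓘(ℝ, E) p p))
    refine this.congr_fderiv ?_
    ext z
    simp
  let V : ∀ q : M, TangentSpace 𝓘(ℝ, E) q := fun q ↦ FiberBundle.extend E (x := p) w q
  have hV : V p = w := FiberBundle.extend_apply_self E (show TangentSpace 𝓘(ℝ, E) p from w)
  have h1 := covAlong_eq (E := E) (f := ψ) (W := fun q ↦ mfderiv 𝓘(ℝ, E) 𝓘(ℝ, E') ψ q (V q))
    (p := p) hd.differentiableAt (by
      filter_upwards [eventually_fderiv_chartRep hψ, chart_source_mem_nhds E p,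
        hψ.continuousAt.eventually (chart_source_mem_nhds E' (ψ p))] with q hq hq1 hq2
      refine ⟨hq2, (hq _).symm.trans ?_⟩
      exact congrArg _ ((congrArg _ (extend_eq_dchartSymm hq1 w)).trans (dchart_dchartSymm hq1 w))) v
  have h2 := covAlong_eq (E := E) (f := fun q : M ↦ q) (W := V) (p := p) (F := fun _ ↦ w)
    (differentiableAt_const _) (by
      filter_upwards [chart_source_mem_nhds E p] with q hq
      exact ⟨hq, (congrArg _ (extend_eq_dchartSymm hq w)).trans (dchart_dchartSymm hq w)⟩) v
  have h3 : dmap E E (fun q : M ↦ q) p v = v := DFunLike.congr_fun (mfderiv_id (x := p)) v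
  rw [hd.fderiv] at h1
  rw [h3] at h2
  have h5 : (covAlong (E := E) (E' := E) (fun q : M ↦ q) V p v : E) = chr p v w := by
    refine h2.trans ?_
    rw [(hasFDerivAt_const w (extChartAt 𝓘(ℝ, E) p p)).fderiv]
    exact (zero_add _).trans (congrArg (chr p v) hV)
  have h6 : dmap E E' ψ p (V p) = dmap E E' ψ p w := congrArg _ hV
  exact congrArg₂ (fun a b : E' ↦ a - b)
    (h1.trans (congrArg (fun u : E' ↦ fderiv ℝ (fderiv ℝ (chartRep E E' ψ p))
      (extChartAt 𝓘(ℝ, E) p p) v w + chr (ψ p) (dmap E E' ψ p v) u) h6))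
    (congrArg (dmap E E' ψ p) h5)

/-- In charts this is the chain rule of second order. The Christoffel term of `M` enters the Hessian
and `dψ (acc x)` with opposite signs and cancels. -/
theorem acc_comp {ψ : M → N} {x : ℝ → M} {t : ℝ}
    (hψ : ContMDiffAt 𝓘(ℝ, E) 𝓘(ℝ, E') 2 ψ (x t)) (hx : ContMDiffAt 𝓘(ℝ, ℝ) 𝓘(ℝ, E) 2 x t) :
    (acc (ψ ∘ x) t : E') = hess E E' ψ (x t) (vel E x t) (vel E x t) + dmap E E' ψ (x t) (acc x t) := by
  have h1 : extChartAt 𝓘(ℝ, E') (ψ (x t)) ∘ ψ ∘ x =ᶠ[𝓝 t]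
      chartRep E E' ψ (x t) ∘ (extChartAt 𝓘(ℝ, E) (x t) ∘ x) :=
    (hx.continuousAt.eventually (chartRep_comp_eventuallyEq ψ (x t))).mono fun s hs ↦ hs.symm
  have hxd : ContDiffAt ℝ 2 (extChartAt 𝓘(ℝ, E) (x t) ∘ x) t :=
    contDiffAt_extChartAt_comp (mem_chart_source E (x t)) hx
  have hv : deriv (extChartAt 𝓘(ℝ, E) (x t) ∘ x) t = vel E x t := by
    rw [← dchart_vel (mem_chart_source E (x t)) (hx.mdifferentiableAt (by simp)), dchart_self]
    rfl
  rw [acc_eq (hψ.comp t hx), acc_eq hx, hess_eq hψ,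
    vel_comp (hψ.mdifferentiableAt (by simp)) (hx.mdifferentiableAt (by simp))]
  have h2 : deriv (deriv (extChartAt 𝓘(ℝ, E') ((ψ ∘ x) t) ∘ ψ ∘ x)) t =
      deriv (deriv (chartRep E E' ψ (x t) ∘ (extChartAt 𝓘(ℝ, E) (x t) ∘ x))) t :=
    h1.deriv.deriv_eq
  rw [h2, deriv_deriv_comp (x := extChartAt 𝓘(ℝ, E) (x t) ∘ x) (contDiffAt_chartRep hψ) hxd, hv, map_add,
    dmap_eq_fderiv_chartRep hψ (deriv _ _)]
  simp only [Function.comp_apply]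
  abel

end Map

/-! ### The first variation formula, and the tension field as a trace. -/

section Vector
variable {E : Type*} [NormedAddCommGroup E] [NormedSpace ℝ E]

theorem hasDerivAt_slice_left {F : Type*} [NormedAddCommGroup F] [NormedSpace ℝ F]
    {y : ℝ × ℝ → F} {s u : ℝ} (hy : DifferentiableAt ℝ y (s, u)) :
    HasDerivAt (fun σ ↦ y (σ, u)) (fderiv ℝ y (s, u) (1, 0)) s :=
  hy.hasFDerivAt.comp_hasDerivAt (f := fun σ ↦ (σ, u)) s
    ((hasDerivAt_id s).prodMk (hasDerivAt_const s u))

theorem hasDerivAt_slice_right {F : Type*} [NormedAddCommGroup F] [NormedSpace ℝ F]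
    {y : ℝ × ℝ → F} {s u : ℝ} (hy : DifferentiableAt ℝ y (s, u)) :
    HasDerivAt (fun υ ↦ y (s, υ)) (fderiv ℝ y (s, u) (0, 1)) u :=
  hy.hasFDerivAt.comp_hasDerivAt (f := fun υ ↦ (s, υ)) u
    ((hasDerivAt_const u s).prodMk (hasDerivAt_id u))

/-- The first variation formula for a metric tensor `g` on a vector space. -/
theorem hasDerivAt_form_slices {g : E → E →L[ℝ] E →L[ℝ] ℝ} {y : ℝ × ℝ → E} {s u : ℝ}
    (hg : DifferentiableAt ℝ g (y (s, u))) (hsymm : ∀ z v w, g z v w = g z w v)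
    (hy : ContDiffAt ℝ 2 y (s, u)) :
    ∃ y₁₁ y₁ y₂ : E, y₁ = fderiv ℝ y (s, u) (1, 0) ∧ y₂ = fderiv ℝ y (s, u) (0, 1) ∧
      HasDerivAt (fun σ ↦ fderiv ℝ y (σ, u) (1, 0)) y₁₁ s ∧
      deriv (fun σ ↦ g (y (σ, u)) (fderiv ℝ y (σ, u) (1, 0)) (fderiv ℝ y (σ, u) (0, 1))) s =
        g (y (s, u)) y₁₁ y₂ + fderiv ℝ g (y (s, u)) y₁ y₁ y₂
          - 1 / 2 * fderiv ℝ g (y (s, u)) y₂ y₁ y₁ + 1 / 2 *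
        deriv (fun υ ↦ g (y (s, υ)) (fderiv ℝ y (s, υ) (1, 0)) (fderiv ℝ y (s, υ) (1, 0))) u := by
  have hy1 : DifferentiableAt ℝ y (s, u) := hy.differentiableAt (by simp)
  have hd : DifferentiableAt ℝ (fderiv ℝ y) (s, u) :=
    (hy.fderiv_right (m := 1) (by norm_num)).differentiableAt (by simp)
  -- Symmetry of second derivatives lets the mixed term `g(y₁, y₁₂)` be recovered from half the
  -- `u`-derivative of `g(y₁, y₁)`.
  have hs := hy.isSymmSndFDerivAt (by simp)
  have hl (a : ℝ × ℝ) : HasDerivAt (fun σ ↦ fderiv ℝ y (σ, u) a)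
      (fderiv ℝ (fderiv ℝ y) (s, u) (1, 0) a) s := by
    simpa using (hasDerivAt_slice_left hd).clm_apply (hasDerivAt_const s a)
  have hr (a : ℝ × ℝ) : HasDerivAt (fun υ ↦ fderiv ℝ y (s, υ) a)
      (fderiv ℝ (fderiv ℝ y) (s, u) (0, 1) a) u := by
    simpa using (hasDerivAt_slice_right hd).clm_apply (hasDerivAt_const u a)
  have hgl : HasDerivAt (fun σ ↦ g (y (σ, u))) _ s :=
    hg.hasFDerivAt.comp_hasDerivAt (f := fun σ ↦ y (σ, u)) s (hasDerivAt_slice_left hy1)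
  have hgr : HasDerivAt (fun υ ↦ g (y (s, υ))) _ u :=
    hg.hasFDerivAt.comp_hasDerivAt (f := fun υ ↦ y (s, υ)) u (hasDerivAt_slice_right hy1)
  refine ⟨_, _, _, rfl, rfl, hl (1, 0), ?_⟩
  rw [((hgl.clm_apply (hl (1, 0))).clm_apply (hl (0, 1))).deriv,
    ((hgr.clm_apply (hr (1, 0))).clm_apply (hr (1, 0))).deriv, hs.eq (1, 0) (0, 1)]
  simp only [add_apply]
  rw [hsymm _ (fderiv ℝ y (s, u) (1, 0)) (fderiv ℝ (fderiv ℝ y) (s, u) (0, 1) (1, 0))]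
  ring

/-- Allows the tension field, defined with a standard basis, to be computed in a basis adapted to
the orbit. Expand each `b i` in `c` and apply Parseval. -/
theorem sum_bilin_orthonormalBasis {V W ι κ : Type*} [NormedAddCommGroup V] [InnerProductSpace ℝ V]
    [AddCommGroup W] [Module ℝ W] [Fintype ι] [Fintype κ] (B : V →ₗ[ℝ] V →ₗ[ℝ] W)
    (b : OrthonormalBasis ι ℝ V) (c : OrthonormalBasis κ ℝ V) :
    ∑ i, B (b i) (b i) = ∑ j, B (c j) (c j) := by
  classical
  have h (i) : B (b i) (b i) =
      ∑ j, ∑ k, (inner ℝ (c j) (b i) * inner ℝ (b i) (c k)) • B (c j) (c k) := by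
    conv_lhs => rw [← c.sum_repr' (b i)]
    simp only [map_sum, map_smul, LinearMap.sum_apply, LinearMap.smul_apply, Finset.smul_sum,
      smul_smul]
    rw [Finset.sum_comm]
    refine Finset.sum_congr rfl fun j _ ↦ Finset.sum_congr rfl fun k _ ↦ ?_
    rw [real_inner_comm (c k) (b i), mul_comm]
  simp only [h]
  rw [Finset.sum_comm]
  refine Finset.sum_congr rfl fun j _ ↦ ?_
  rw [Finset.sum_comm]
  simp only [← Finset.sum_smul, b.sum_inner_mul_inner, c.inner_eq_ite]
  simp

end Vector

section Chart
variable {E : Type*} [NormedAddCommGroup E] [NormedSpace ℝ E] [FiniteDimensional ℝ E]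
  {M : Type*} [TopologicalSpace M] [ChartedSpace E M] [IsManifold 𝓘(ℝ, E) ∞ M]

theorem slice_left {f : ℝ → ℝ → M} {s u : ℝ} {n : WithTop ℕ∞}
    (hf : ContMDiffAt 𝓘(ℝ, ℝ × ℝ) 𝓘(ℝ, E) n (fun z : ℝ × ℝ ↦ f z.1 z.2) (s, u)) :
    ContMDiffAt 𝓘(ℝ, ℝ) 𝓘(ℝ, E) n (fun σ ↦ f σ u) s :=
  ContMDiffAt.comp (g := fun z : ℝ × ℝ ↦ f z.1 z.2) (f := fun σ ↦ (σ, u)) s hf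
    (contDiffAt_id.prodMk contDiffAt_const).contMDiffAt

theorem slice_right {f : ℝ → ℝ → M} {s u : ℝ} {n : WithTop ℕ∞}
    (hf : ContMDiffAt 𝓘(ℝ, ℝ × ℝ) 𝓘(ℝ, E) n (fun z : ℝ × ℝ ↦ f z.1 z.2) (s, u)) :
    ContMDiffAt 𝓘(ℝ, ℝ) 𝓘(ℝ, E) n (f s) u :=
  ContMDiffAt.comp (g := fun z : ℝ × ℝ ↦ f z.1 z.2) (f := fun υ ↦ (s, υ)) u hf
    (contDiffAt_const.prodMk contDiffAt_id).contMDiffAt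

theorem eventually_dchart_slices {f : ℝ → ℝ → M} {s u : ℝ} {p : M}
    (hp : f s u ∈ (chartAt E p).source)
    (hf : ContMDiffAt 𝓘(ℝ, ℝ × ℝ) 𝓘(ℝ, E) 2 (fun z : ℝ × ℝ ↦ f z.1 z.2) (s, u)) :
    ContDiffAt ℝ 2 (fun z : ℝ × ℝ ↦ extChartAt 𝓘(ℝ, E) p (f z.1 z.2)) (s, u) ∧
    ∀ᶠ z in 𝓝 (s, u), f z.1 z.2 ∈ (chartAt E p).source ∧
      dchart p (f z.1 z.2) (vel E (fun σ ↦ f σ z.2) z.1) =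
        fderiv ℝ (fun z : ℝ × ℝ ↦ extChartAt 𝓘(ℝ, E) p (f z.1 z.2)) z (1, 0) ∧
      dchart p (f z.1 z.2) (vel E (f z.1) z.2) =
        fderiv ℝ (fun z : ℝ × ℝ ↦ extChartAt 𝓘(ℝ, E) p (f z.1 z.2)) z (0, 1) := by
  have hy : ContDiffAt ℝ 2 (fun z : ℝ × ℝ ↦ extChartAt 𝓘(ℝ, E) p (f z.1 z.2)) (s, u) := by
    rw [← contMDiffAt_iff_contDiffAt]
    exact (contMDiffAt_extChartAt' (n := 2) hp).comp (s, u) hf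
  refine ⟨hy, ?_⟩
  filter_upwards [hf.continuousAt.eventually ((chartAt E p).open_source.mem_nhds hp),
    (contMDiffAt_iff_contMDiffAt_nhds (by simp)).1 hf, hy.eventually (by simp)] with z hz hz1 hz2
  refine ⟨hz, ?_, ?_⟩
  · rw [dchart_vel (x := fun σ ↦ f σ z.2) hz ((slice_left (u := z.2) hz1).mdifferentiableAt (by simp))]
    exact (hasDerivAt_slice_left (hz2.differentiableAt (by simp))).deriv
  · rw [dchart_vel hz ((slice_right (s := z.1) hz1).mdifferentiableAt (by simp))]
    exact (hasDerivAt_slice_right (hz2.differentiableAt (by simp))).deriv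

variable [RiemannianBundle (fun p : M ↦ TangentSpace 𝓘(ℝ, E) p)]
  [IsContMDiffRiemannianBundle 𝓘(ℝ, E) ∞ E (fun p : M ↦ TangentSpace 𝓘(ℝ, E) p)]

/-- The chart is not required to be centred at `f s u`: the geodesic equation is needed in one fixed
chart along a piece of the curve. -/
theorem first_variation_chart {f : ℝ → ℝ → M} {s u : ℝ} {p : M}
    (hp : f s u ∈ (chartAt E p).source)
    (hf : ContMDiffAt 𝓘(ℝ, ℝ × ℝ) 𝓘(ℝ, E) 2 (fun z : ℝ × ℝ ↦ f z.1 z.2) (s, u)) :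
    deriv (fun σ ↦ met (f σ u) (vel E (fun σ' ↦ f σ' u) σ) (vel E (f σ) u)) s =
      chartMetric p (extChartAt 𝓘(ℝ, E) p (f s u))
        (deriv (deriv (extChartAt 𝓘(ℝ, E) p ∘ fun σ ↦ f σ u)) s)
        (dchart p (f s u) (vel E (f s) u))
      + fderiv ℝ (chartMetric p) (extChartAt 𝓘(ℝ, E) p (f s u))
        (dchart p (f s u) (vel E (fun σ' ↦ f σ' u) s))
        (dchart p (f s u) (vel E (fun σ' ↦ f σ' u) s))
        (dchart p (f s u) (vel E (f s) u))
      - 1 / 2 * fderiv ℝ (chartMetric p) (extChartAt 𝓘(ℝ, E) p (f s u))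
        (dchart p (f s u) (vel E (f s) u))
        (dchart p (f s u) (vel E (fun σ' ↦ f σ' u) s))
        (dchart p (f s u) (vel E (fun σ' ↦ f σ' u) s))
      + 1 / 2 * deriv (fun υ ↦ met (f s υ) (vel E (fun σ' ↦ f σ' υ) s)
          (vel E (fun σ' ↦ f σ' υ) s)) u := by
  obtain ⟨hy, hev⟩ := eventually_dchart_slices hp hf
  obtain ⟨y₁₁, y₁, y₂, hy₁, hy₂, h₁₁, h⟩ := hasDerivAt_form_slices (g := chartMetric p)
    ((contDiffAt_chartMetric ((extChartAt 𝓘(ℝ, E) p).map_source (by simpa using hp))).differentiableAt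
      (by simp)) (chartMetric_comm p) hy
  have hl := ((Continuous.prodMk_left u).tendsto s).eventually hev
  have hr := ((Continuous.prodMk_right s).tendsto u).eventually hev
  obtain ⟨-, e1, e2⟩ := hev.self_of_nhds
  have e3 : (fun σ ↦ fderiv ℝ (fun z : ℝ × ℝ ↦ extChartAt 𝓘(ℝ, E) p (f z.1 z.2)) (σ, u) (1, 0))
      =ᶠ[𝓝 s] deriv (extChartAt 𝓘(ℝ, E) p ∘ fun σ ↦ f σ u) := by
    filter_upwards [((Continuous.prodMk_left u).tendsto s).eventually (hy.eventually (by simp))]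
      with σ hσ
    exact (hasDerivAt_slice_left (hσ.differentiableAt (by simp))).deriv.symm
  rw [← hy₁] at e1
  rw [← hy₂] at e2
  rw [← e1, ← e2, ← (h₁₁.congr_of_eventuallyEq e3.symm).deriv] at h
  refine Eq.trans (Filter.EventuallyEq.deriv_eq ?_) (h.trans (congrArg₂ (· + ·) rfl
    (congrArg _ (Filter.EventuallyEq.deriv_eq ?_).symm)))
  · filter_upwards [hl] with σ hσ
    rw [met_eq_chartMetric hσ.1, hσ.2.1, hσ.2.2]
  · filter_upwards [hr] with σ hσ
    rw [met_eq_chartMetric hσ.1, hσ.2.1]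

/-- The first variation formula. -/
theorem first_variation {f : ℝ → ℝ → M} {s u : ℝ}
    (hf : ContMDiffAt 𝓘(ℝ, ℝ × ℝ) 𝓘(ℝ, E) 2 (fun z : ℝ × ℝ ↦ f z.1 z.2) (s, u)) :
    deriv (fun σ ↦ met (f σ u) (vel E (fun σ' ↦ f σ' u) σ) (vel E (f σ) u)) s =
      met (f s u) (acc (fun σ ↦ f σ u) s) (vel E (f s) u)
      + 1 / 2 * deriv (fun υ ↦ met (f s υ) (vel E (fun σ' ↦ f σ' υ) s)
          (vel E (fun σ' ↦ f σ' υ) s)) u := by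
  rw [first_variation_chart (mem_chart_source E (f s u)) hf, acc_eq (slice_left hf),
    met_eq_chartMetric (mem_chart_source E (f s u))]
  -- In the centred chart the metric derivatives are the Koszul expression of the Christoffel symbol
  -- with two equal arguments.
  have h2 : chartMetric (f s u) (extChartAt 𝓘(ℝ, E) (f s u) (f s u)) (dchart (f s u) (f s u)
      (chr (f s u) (vel E (fun σ ↦ f σ u) s) (vel E (fun σ ↦ f σ u) s)))
      (dchart (f s u) (f s u) (vel E (f s) u)) = _ :=
    (met_eq_chartMetric (mem_chart_source E (f s u)) _ _).symm.trans (met_chr _ _ _ _)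
  simp only [dchart_self, ContinuousLinearMap.id_apply, map_add, add_apply] at h2 ⊢
  rw [h2]
  ring

theorem acc_congr {x y : ℝ → M} {t : ℝ} (h : x =ᶠ[𝓝 t] y)
    (hx : ContMDiffAt 𝓘(ℝ, ℝ) 𝓘(ℝ, E) 2 x t) : (acc x t : E) = acc y t := by
  have hv : vel E x t = vel E y t := DFunLike.congr_fun (h.mfderiv_eq) (1 : ℝ)
  have h2 : deriv (deriv (extChartAt 𝓘(ℝ, E) (y t) ∘ x)) t =
      deriv (deriv (extChartAt 𝓘(ℝ, E) (y t) ∘ y)) t :=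
    Filter.EventuallyEq.deriv_eq (Filter.EventuallyEq.deriv (h.fun_comp _))
  rw [acc_eq hx, acc_eq (hx.congr_of_eventuallyEq h.symm), h.eq_of_nhds, hv, h2]

end Chart

section Map
variable {E : Type*} [NormedAddCommGroup E] [NormedSpace ℝ E] [FiniteDimensional ℝ E]
  {M : Type*} [TopologicalSpace M] [ChartedSpace E M] [IsManifold 𝓘(ℝ, E) ∞ M]
  {E' : Type*} [NormedAddCommGroup E'] [NormedSpace ℝ E'] [FiniteDimensional ℝ E']
  {N : Type*} [TopologicalSpace N] [ChartedSpace E' N] [IsManifold 𝓘(ℝ, E') ∞ N]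
  [RiemannianBundle (fun p : N ↦ TangentSpace 𝓘(ℝ, E') p)]
  [IsContMDiffRiemannianBundle 𝓘(ℝ, E') ∞ E' (fun p : N ↦ TangentSpace 𝓘(ℝ, E') p)]
  [RiemannianBundle (fun p : M ↦ TangentSpace 𝓘(ℝ, E) p)]
  [IsContMDiffRiemannianBundle 𝓘(ℝ, E) ∞ E (fun p : M ↦ TangentSpace 𝓘(ℝ, E) p)]

theorem exists_bilin_eq_hess {ψ : M → N} {p : M} (hψ : ContMDiffAt 𝓘(ℝ, E) 𝓘(ℝ, E') 2 ψ p) :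
    ∃ B : E →ₗ[ℝ] E →ₗ[ℝ] E', ∀ v w, B v w = hess E E' ψ p v w := by
  refine ⟨LinearMap.mk₂ ℝ (hess E E' ψ p) ?_ ?_ ?_ ?_, fun v w ↦ rfl⟩ <;> intros <;>
    simp only [hess_eq hψ, ← christoffelBilin_apply, map_add, map_smul, add_apply, smul_apply,
      LinearMap.add_apply, LinearMap.smul_apply] <;> module

variable (E E') in
theorem tension_eq_sum {ψ : M → N} {p : M} (hψ : ContMDiffAt 𝓘(ℝ, E) 𝓘(ℝ, E') 2 ψ p)
    {ι : Type*} [Fintype ι] (b : OrthonormalBasis ι ℝ (TangentSpace 𝓘(ℝ, E) p)) :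
    (tension E E' ψ p : E') = ∑ i, hess E E' ψ p (b i) (b i) := by
  obtain ⟨B, hB⟩ := exists_bilin_eq_hess (E := E) (E' := E') hψ
  have h := sum_bilin_orthonormalBasis (V := TangentSpace 𝓘(ℝ, E) p) B (stdOrthonormalBasis ℝ _) b
  exact (Finset.sum_congr rfl fun i _ ↦ (hB _ _).symm).trans
    (h.trans (Finset.sum_congr rfl fun i _ ↦ hB _ _))

end Map

/-! ### Uniqueness of geodesics and their invariance under isometries. -/

section Vector
variable {E : Type*} [NormedAddCommGroup E] [NormedSpace ℝ E] [FiniteDimensional ℝ E]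

theorem two_le_infty : (2 : WithTop ℕ∞) ≤ ∞ := ENat.LEInfty.out

/-- The geodesic spray of a metric tensor `g` on a vector space. -/
def spray (g : E → E →L[ℝ] E →L[ℝ] ℝ) (z : E × E) : E :=
  (g z.1).inverse ((1 / 2 : ℝ) • ((fderiv ℝ g z.1).flip z.2).flip z.2 - fderiv ℝ g z.1 z.2 z.2)

/-- A nondegenerate form identifies the space with its dual. -/
def formEquiv (g : E →L[ℝ] E →L[ℝ] ℝ) (hg : ∀ v, g v v = 0 → v = 0) : E ≃L[ℝ] (E →L[ℝ] ℝ) :=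
  (LinearEquiv.ofInjectiveOfFinrankEq g.toLinearMap
    ((injective_iff_map_eq_zero g.toLinearMap).2 fun v hv ↦ hg v (by
      have : g v = 0 := hv
      rw [this]; rfl))
    (by
      rw [← LinearMap.toContinuousLinearMap (𝕜 := ℝ) (E := E) (F' := ℝ) |>.finrank_eq]
      exact (Subspace.dual_finrank_eq (K := ℝ) (V := E)).symm)).toContinuousLinearEquiv

theorem coe_formEquiv (g : E →L[ℝ] E →L[ℝ] ℝ) (hg : ∀ v, g v v = 0 → v = 0) :
    (formEquiv g hg : E →L[ℝ] (E →L[ℝ] ℝ)) = g := by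
  ext v w
  rfl

/-- The hypothesis is the Euler–Lagrange equation tested on all `w`; definiteness of `g y` allows it
to be solved for `a`. -/
theorem eq_spray {g : E → E →L[ℝ] E →L[ℝ] ℝ} {y v a : E} (hg : ∀ v, g y v v = 0 → v = 0)
    (h : ∀ w, g y a w + fderiv ℝ g y v v w - 1 / 2 * fderiv ℝ g y w v v = 0) :
    a = spray g (y, v) := by
  have h1 : g y a = (1 / 2 : ℝ) • ((fderiv ℝ g y).flip v).flip v - fderiv ℝ g y v v := by
    ext w
    simp only [sub_apply, smul_apply, ContinuousLinearMap.flip_apply, smul_eq_mul]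
    linarith [h w]
  unfold spray
  dsimp only
  rw [← h1, ← coe_formEquiv (g y) hg, ContinuousLinearMap.inverse_equiv]
  simp

theorem contDiffAt_spray {g : E → E →L[ℝ] E →L[ℝ] ℝ} {y v : E} (hg : ∀ v, g y v v = 0 → v = 0)
    (hd : ContDiffAt ℝ ∞ g y) : ContDiffAt ℝ 1 (spray g) (y, v) := by
  have h1 : ContDiffAt ℝ 1 (fun z : E × E ↦ (g z.1).inverse) (y, v) := by
    have := contDiffAt_map_inverse (𝕜 := ℝ) (n := 1) (formEquiv (g y) hg)
    rw [coe_formEquiv] at this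
    exact this.comp (y, v) ((hd.of_le (by simp)).comp (y, v) contDiffAt_fst)
  have h2 : ContDiffAt ℝ 1 (fun z : E × E ↦ fderiv ℝ g z.1) (y, v) :=
    (hd.fderiv_right (m := 1) (by norm_num; exact two_le_infty)).comp (y, v) contDiffAt_fst
  refine h1.clm_apply (ContDiffAt.sub (ContDiffAt.const_smul _ ?_) ?_)
  · have h3 := ((ContinuousLinearMap.flipₗᵢ ℝ E E (E →L[ℝ] ℝ)).contDiff.contDiffAt.comp (y, v)
      h2).clm_apply contDiffAt_snd
    exact ((ContinuousLinearMap.flipₗᵢ ℝ E E ℝ).contDiff.contDiffAt.comp (y, v) h3).clm_apply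
      contDiffAt_snd
  · exact (h2.clm_apply contDiffAt_snd).clm_apply contDiffAt_snd

/-- Solutions of a second order equation are determined by their position and velocity. -/
theorem eventuallyEq_of_deriv_deriv_eq {S : E × E → E} {x y : ℝ → E} {t : ℝ}
    (hS : ContDiffAt ℝ 1 S (x t, deriv x t)) (hx : ContDiffAt ℝ 2 x t) (hy : ContDiffAt ℝ 2 y t)
    (hxS : ∀ᶠ s in 𝓝 t, deriv (deriv x) s = S (x s, deriv x s))
    (hyS : ∀ᶠ s in 𝓝 t, deriv (deriv y) s = S (y s, deriv y s))
    (h0 : x t = y t) (h1 : deriv x t = deriv y t) : x =ᶠ[𝓝 t] y := by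
  -- Position and velocity together solve a first-order system whose field is `C¹`, hence locally
  -- Lipschitz.
  have hV : ContDiffAt ℝ 1 (fun z : E × E ↦ (z.2, S z)) (x t, deriv x t) :=
    contDiffAt_snd.prodMk hS
  obtain ⟨K, s, hs, hK⟩ := hV.exists_lipschitzOnWith
  have key : ∀ {c : ℝ → E}, ContDiffAt ℝ 2 c t → (∀ᶠ s in 𝓝 t, deriv (deriv c) s = S (c s, deriv c s)) →
      (c t, deriv c t) = (x t, deriv x t) → ∀ᶠ τ in 𝓝 t, HasDerivAt (fun τ ↦ (c τ, deriv c τ))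
        ((fun z : E × E ↦ (z.2, S z)) (c τ, deriv c τ)) τ ∧ (c τ, deriv c τ) ∈ s := by
    intro c hc hcS he
    have hd : ContDiffAt ℝ 1 (deriv c) t := by
      have := (hc.fderiv_right (m := 1) (by norm_num))
      exact this.clm_apply contDiffAt_const
    have hcont : ContinuousAt (fun τ ↦ (c τ, deriv c τ)) t := hc.continuousAt.prodMk hd.continuousAt
    have hmem := hcont.eventually (he ▸ hs : s ∈ 𝓝 (c t, deriv c t))
    filter_upwards [hcS, hc.eventually (by simp), hd.eventually (by simp), hmem] with τ h1 h2 h3 h4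
    refine ⟨?_, h4⟩
    have := (h3.differentiableAt (by simp)).hasDerivAt
    rw [h1] at this
    exact (h2.differentiableAt (by simp)).hasDerivAt.prodMk this
  have := ODE_solution_unique_of_eventually (v := fun _ z ↦ (z.2, S z)) (s := fun _ ↦ s) (K := K)
    (Filter.Eventually.of_forall fun _ ↦ hK) (key hx hxS rfl) (key hy hyS (by rw [h0, h1]))
    (by rw [h0, h1])
  exact this.mono fun τ hτ ↦ congrArg Prod.fst hτ

end Vector

section Chart
variable {E : Type*} [NormedAddCommGroup E] [NormedSpace ℝ E] [FiniteDimensional ℝ E]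
  {M : Type*} [TopologicalSpace M] [ChartedSpace E M] [IsManifold 𝓘(ℝ, E) ∞ M]
  [RiemannianBundle (fun p : M ↦ TangentSpace 𝓘(ℝ, E) p)]

variable (E) in
/-- A critical point of the energy: the first variation of the energy density is a total
derivative. -/
structure IsExtremal (x : ℝ → M) : Prop where
  contMDiff : ContMDiff 𝓘(ℝ, ℝ) 𝓘(ℝ, E) 2 x
  euler_lagrange : ∀ (f : ℝ → ℝ → M) (s : ℝ),
    ContMDiffAt 𝓘(ℝ, ℝ × ℝ) 𝓘(ℝ, E) 2 (fun z : ℝ × ℝ ↦ f z.1 z.2) (s, 0) →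
    (∀ᶠ σ in 𝓝 s, f σ 0 = x σ) →
    deriv (fun σ ↦ met (f σ 0) (vel E (fun σ' ↦ f σ' 0) σ) (vel E (f σ) 0)) s =
      1 / 2 * deriv (fun υ ↦ met (f s υ) (vel E (fun σ' ↦ f σ' υ) s)
        (vel E (fun σ' ↦ f σ' υ) s)) 0

/-- A smooth map that preserves the inner products of tangent vectors. -/
structure IsLocalIsometry (Φ : M → M) : Prop where
  contMDiff : ContMDiff 𝓘(ℝ, E) 𝓘(ℝ, E) ∞ Φ
  met_dmap : ∀ (p : M) (v w : E), met (Φ p) (dmap E E Φ p v) (dmap E E Φ p w) = met p v w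

/-- The variational condition involves only inner products of velocities. An isometry carries
variations of `x` to variations of `Φ ∘ x` with the same inner products, so no transformation law
for Christoffel symbols is needed. -/
theorem IsExtremal.of_comp {Φ : M → M} {x : ℝ → M} (hΦ : IsLocalIsometry (E := E) Φ)
    (hx : ContMDiff 𝓘(ℝ, ℝ) 𝓘(ℝ, E) 2 x) (h : IsExtremal E (Φ ∘ x)) : IsExtremal E x := by
  refine ⟨hx, fun f s hf hfx ↦ ?_⟩
  have hΦ2 : ContMDiff 𝓘(ℝ, E) 𝓘(ℝ, E) 2 Φ := hΦ.contMDiff.of_le two_le_infty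
  have hd (p : M) : MDifferentiableAt 𝓘(ℝ, E) 𝓘(ℝ, E) Φ p := (hΦ2 p).mdifferentiableAt (by simp)
  have h1 := h.euler_lagrange (fun σ υ ↦ Φ (f σ υ)) s
    (ContMDiffAt.comp (g := Φ) (f := fun z : ℝ × ℝ ↦ f z.1 z.2) (s, 0) (hΦ2 _) hf)
    (hfx.mono fun σ hσ ↦ congrArg Φ hσ)
  have hev := (contMDiffAt_iff_contMDiffAt_nhds (by simp)).1 hf
  have hl := ((Continuous.prodMk_left (0 : ℝ)).tendsto s).eventually hev
  have hr := ((Continuous.prodMk_right s).tendsto (0 : ℝ)).eventually hev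
  have e1 {σ υ : ℝ} (hz : ContMDiffAt 𝓘(ℝ, ℝ × ℝ) 𝓘(ℝ, E) 2 (fun z : ℝ × ℝ ↦ f z.1 z.2) (σ, υ)) :
      vel E (fun σ' ↦ Φ (f σ' υ)) σ = dmap E E Φ (f σ υ) (vel E (fun σ' ↦ f σ' υ) σ) :=
    vel_comp (hd _) ((slice_left hz).mdifferentiableAt (by simp))
  have e2 {σ υ : ℝ} (hz : ContMDiffAt 𝓘(ℝ, ℝ × ℝ) 𝓘(ℝ, E) 2 (fun z : ℝ × ℝ ↦ f z.1 z.2) (σ, υ)) :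
      vel E (fun υ' ↦ Φ (f σ υ')) υ = dmap E E Φ (f σ υ) (vel E (f σ) υ) :=
    vel_comp (hd _) ((slice_right hz).mdifferentiableAt (by simp))
  refine (Filter.EventuallyEq.deriv_eq ?_).trans (h1.trans
    (congrArg _ (Filter.EventuallyEq.deriv_eq ?_)))
  · filter_upwards [hl] with σ hσ
    rw [e1 hσ, e2 hσ, hΦ.met_dmap]
  · filter_upwards [hr] with σ hσ
    rw [e1 hσ, hΦ.met_dmap]

variable [IsContMDiffRiemannianBundle 𝓘(ℝ, E) ∞ E (fun p : M ↦ TangentSpace 𝓘(ℝ, E) p)]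

theorem IsGeodesic.isExtremal {x : ℝ → M} (hx : IsGeodesic (E' := E) x) : IsExtremal E x := by
  have h2 : ContMDiff 𝓘(ℝ, ℝ) 𝓘(ℝ, E) 2 x := hx.smooth.of_le two_le_infty
  refine ⟨h2, fun f s hf hfx ↦ ?_⟩
  have hacc : (acc (fun σ ↦ f σ 0) s : E) = 0 :=
    (acc_congr hfx (slice_left hf)).trans (hx.acceleration_eq_zero s)
  rw [first_variation hf, hacc, map_zero, zero_apply, zero_add]

theorem IsExtremal.deriv_deriv_eq {x : ℝ → M} (hx : IsExtremal E x) {p : M} {s : ℝ}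
    (hp : x s ∈ (chartAt E p).source) :
    deriv (deriv (extChartAt 𝓘(ℝ, E) p ∘ x)) s = spray (chartMetric p)
      (extChartAt 𝓘(ℝ, E) p (x s), deriv (extChartAt 𝓘(ℝ, E) p ∘ x) s) := by
  have hp' : extChartAt 𝓘(ℝ, E) p (x s) ∈ (extChartAt 𝓘(ℝ, E) p).target :=
    (extChartAt 𝓘(ℝ, E) p).map_source (by simpa using hp)
  refine eq_spray (fun v hv ↦ (chartMetric_self_eq_zero hp').1 hv) fun w ↦ ?_
  -- This variation shifts the coordinates of `x` in the constant direction `w`. Its `υ`-velocity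
  -- has components `w`, so the Euler–Lagrange condition is tested on `w`.
  let f : ℝ → ℝ → M := fun σ υ ↦
    (extChartAt 𝓘(ℝ, E) p).symm (extChartAt 𝓘(ℝ, E) p (x σ) + υ • w)
  have hf0 : ∀ᶠ σ in 𝓝 s, f σ 0 = x σ := by
    filter_upwards [(hx.contMDiff s).continuousAt.eventually
      ((chartAt E p).open_source.mem_nhds hp)] with σ hσ
    simp only [f, zero_smul, add_zero]
    exact (extChartAt 𝓘(ℝ, E) p).left_inv (by rw [extChartAt_source]; exact hσ)
  have hxd : ContDiffAt ℝ 2 (extChartAt 𝓘(ℝ, E) p ∘ x) s :=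
    contDiffAt_extChartAt_comp hp (hx.contMDiff s)
  have hf : ContMDiffAt 𝓘(ℝ, ℝ × ℝ) 𝓘(ℝ, E) 2 (fun z : ℝ × ℝ ↦ f z.1 z.2) (s, 0) := by
    have hz : extChartAt 𝓘(ℝ, E) p (x s) + (0 : ℝ) • w ∈ (extChartAt 𝓘(ℝ, E) p).target := by
      simpa using hp'
    have h1 : ContMDiffAt 𝓘(ℝ, E) 𝓘(ℝ, E) 2 (extChartAt 𝓘(ℝ, E) p).symm
        (extChartAt 𝓘(ℝ, E) p (x s) + (0 : ℝ) • w) :=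
      (contMDiffOn_extChartAt_symm (n := 2) p).contMDiffAt ((isOpen_extChartAt_target p).mem_nhds hz)
    refine ContMDiffAt.comp (f := fun z : ℝ × ℝ ↦ extChartAt 𝓘(ℝ, E) p (x z.1) + z.2 • w) (s, 0) h1 ?_
    rw [contMDiffAt_iff_contDiffAt]
    exact (ContDiffAt.comp (f := Prod.fst) (s, (0 : ℝ)) hxd contDiffAt_fst).add
      (contDiffAt_snd.smul contDiffAt_const)
  have hfs : f s 0 = x s := hf0.self_of_nhds
  have h1 := first_variation_chart (p := p) (hfs ▸ hp) hf
  rw [hx.euler_lagrange f s hf hf0] at h1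
  have e0 : extChartAt 𝓘(ℝ, E) p ∘ (fun σ ↦ f σ 0) =ᶠ[𝓝 s] extChartAt 𝓘(ℝ, E) p ∘ x :=
    hf0.mono fun σ hσ ↦ congrArg _ hσ
  have e1 : dchart p (f s 0) (vel E (fun σ' ↦ f σ' 0) s) = deriv (extChartAt 𝓘(ℝ, E) p ∘ x) s := by
    rw [dchart_vel (x := fun σ ↦ f σ 0) (hfs ▸ hp) ((slice_left hf).mdifferentiableAt (by simp)),
      e0.deriv_eq]
  have e2 : dchart p (f s 0) (vel E (f s) 0) = w := by
    rw [dchart_vel (hfs ▸ hp) ((slice_right hf).mdifferentiableAt (by simp))]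
    have hev : extChartAt 𝓘(ℝ, E) p ∘ f s =ᶠ[𝓝 0]
        fun υ : ℝ ↦ extChartAt 𝓘(ℝ, E) p (x s) + υ • w := by
      have hc : ContinuousAt (fun υ : ℝ ↦ extChartAt 𝓘(ℝ, E) p (x s) + υ • w) 0 := by fun_prop
      filter_upwards [hc.eventually ((isOpen_extChartAt_target p).mem_nhds
        (show extChartAt 𝓘(ℝ, E) p (x s) + (0 : ℝ) • w ∈ _ by rwa [zero_smul, add_zero]))] with υ hυ
      exact (extChartAt 𝓘(ℝ, E) p).right_inv hυ
    rw [hev.deriv_eq]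
    simpa using (((hasDerivAt_id (0 : ℝ)).smul_const w).const_add
      (extChartAt 𝓘(ℝ, E) p (x s))).deriv
  rw [e1, e2, e0.deriv.deriv_eq, hfs] at h1
  exact (add_eq_right.1 h1.symm)

theorem IsExtremal.eventuallyEq {x y : ℝ → M} (hx : IsExtremal E x) (hy : IsExtremal E y) {t : ℝ}
    (h0 : x t = y t) (h1 : vel E x t = vel E y t) : x =ᶠ[𝓝 t] y := by
  have hpx : x t ∈ (chartAt E (x t)).source := mem_chart_source E (x t)
  have hpy : y t ∈ (chartAt E (x t)).source := h0 ▸ hpx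
  have hsx := (hx.contMDiff t).continuousAt.eventually ((chartAt E (x t)).open_source.mem_nhds hpx)
  have hsy := (hy.contMDiff t).continuousAt.eventually ((chartAt E (x t)).open_source.mem_nhds hpy)
  have key := eventuallyEq_of_deriv_deriv_eq
    (x := extChartAt 𝓘(ℝ, E) (x t) ∘ x) (y := extChartAt 𝓘(ℝ, E) (x t) ∘ y) (t := t)
    (contDiffAt_spray (g := chartMetric (x t))
      (fun v hv ↦ (chartMetric_self_eq_zero (mem_extChartAt_target (x t))).1 hv)
      (contDiffAt_chartMetric (mem_extChartAt_target (x t))))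
    (contDiffAt_extChartAt_comp hpx (hx.contMDiff t)) (contDiffAt_extChartAt_comp hpy (hy.contMDiff t))
    (hsx.mono fun s hs ↦ hx.deriv_deriv_eq hs) (hsy.mono fun s hs ↦ hy.deriv_deriv_eq hs)
    (congrArg _ h0) (by
      rw [← dchart_vel hpx ((hx.contMDiff t).mdifferentiableAt (by simp)),
        ← dchart_vel hpy ((hy.contMDiff t).mdifferentiableAt (by simp)), h1, ← h0])
  filter_upwards [key, hsx, hsy] with s hs h2 h3
  exact (extChartAt 𝓘(ℝ, E) (x t)).injOn (by rw [extChartAt_source]; exact h2)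
    (by rw [extChartAt_source]; exact h3) hs

/-- Geodesics are determined by their position and velocity at one time. -/
theorem IsExtremal.eq [T2Space M] {x y : ℝ → M} (hx : IsExtremal E x) (hy : IsExtremal E y) {t : ℝ}
    (h0 : x t = y t) (h1 : vel E x t = vel E y t) : x = y := by
  have hopen : IsOpen {s | x =ᶠ[𝓝 s] y} := by
    rw [isOpen_iff_mem_nhds]
    exact fun s hs ↦ hs.eventuallyEq_nhds
  -- At a limit point of the agreement set, values and velocities agree by continuity (the values
  -- because `M` is Hausdorff), and local uniqueness gives equal germs there.
  have hclosed : IsClosed {s | x =ᶠ[𝓝 s] y} := by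
    rw [← isOpen_compl_iff, isOpen_iff_mem_nhds]
    intro s hs
    by_contra hcon
    have hfr : ∃ᶠ τ in 𝓝 s, x =ᶠ[𝓝 τ] y := fun h ↦ hcon h
    have h0 : x s = y s := by
      by_contra hne
      have := (isClosed_eq hx.contMDiff.continuous hy.contMDiff.continuous).isOpen_compl.mem_nhds
        (show s ∈ {s | x s = y s}ᶜ from hne)
      exact hfr (Filter.mem_of_superset this fun τ hτ h ↦ hτ h.eq_of_nhds)
    refine hs (hx.eventuallyEq hy h0 ?_)
    have hpx : x s ∈ (chartAt E (x s)).source := mem_chart_source E (x s)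
    have hpy : y s ∈ (chartAt E (x s)).source := h0 ▸ hpx
    have hdx := contDiffAt_extChartAt_comp hpx (hx.contMDiff s)
    have hdy := contDiffAt_extChartAt_comp hpy (hy.contMDiff s)
    have hc {c : ℝ → E} (hc : ContDiffAt ℝ 2 c s) : ContinuousAt (deriv c) s :=
      ((hc.fderiv_right (m := 1) (by norm_num)).clm_apply
        (contDiffAt_const (c := (1 : ℝ)))).continuousAt
    have e : deriv (extChartAt 𝓘(ℝ, E) (x s) ∘ x) s = deriv (extChartAt 𝓘(ℝ, E) (x s) ∘ y) s := by
      by_contra hne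
      have := ((hc hdx).ne_iff_eventually_ne (hc hdy)).1 hne
      exact hfr (this.mono fun τ hτ h ↦ hτ (h.fun_comp _).deriv_eq)
    rw [← dchart_vel hpx ((hx.contMDiff s).mdifferentiableAt (by simp)),
      ← dchart_vel hpy ((hy.contMDiff s).mdifferentiableAt (by simp)), ← h0] at e
    simpa [dchart_self] using e
  have huniv := IsClopen.eq_univ ⟨hclosed, hopen⟩ ⟨t, hx.eventuallyEq hy h0 h1⟩
  funext s
  exact Filter.EventuallyEq.eq_of_nhds (show s ∈ {s | x =ᶠ[𝓝 s] y} from huniv ▸ Set.mem_univ s)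

end Chart

/-! ### Curves in Lie groups, action fields and isotropy. -/

section LieGroup
variable {EG : Type*} [NormedAddCommGroup EG] [NormedSpace ℝ EG] [FiniteDimensional ℝ EG]
  {G : Type*} [TopologicalSpace G] [ChartedSpace EG G] [Group G] [LieGroup 𝓘(ℝ, EG) ∞ G]

/-- The differential of multiplication at `(1, 1)` is addition. -/
theorem vel_mul_self {c : ℝ → G} (h1 : c 0 = 1) (hc : MDifferentiableAt 𝓘(ℝ, ℝ) 𝓘(ℝ, EG) c 0) :
    vel EG (fun s ↦ c s * c s) 0 = (2 : ℝ) • vel EG c 0 := by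
  have hm : MDifferentiableAt (𝓘(ℝ, EG).prod 𝓘(ℝ, EG)) 𝓘(ℝ, EG) (fun z : G × G ↦ z.1 * z.2)
      (c 0, c 0) := (contMDiff_mul 𝓘(ℝ, EG) ∞).mdifferentiable (by simp) _
  have h2 := HasMFDerivAt.comp (0 : ℝ) (f := fun s ↦ (c s, c s)) hm.hasMFDerivAt
    (hc.hasMFDerivAt.prodMk hc.hasMFDerivAt)
  have h3 : vel EG (fun s ↦ c s * c s) 0 = mfderiv (𝓘(ℝ, EG).prod 𝓘(ℝ, EG)) 𝓘(ℝ, EG)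
      (fun z : G × G ↦ z.1 * z.2) (c 0, c 0) (vel EG c 0, vel EG c 0) :=
    DFunLike.congr_fun h2.mfderiv (1 : ℝ)
  refine h3.trans ((mfderiv_prod_eq_add_apply hm).trans ?_)
  have e1 : dmap EG EG (fun z : G ↦ z * c 0) (c 0) (vel EG c 0) = vel EG c 0 := by
    simp only [h1, mul_one]
    exact DFunLike.congr_fun (mfderiv_id (I := 𝓘(ℝ, EG)) (x := (1 : G))) _
  have e2 : dmap EG EG (fun z : G ↦ c 0 * z) (c 0) (vel EG c 0) = vel EG c 0 := by
    simp only [h1, one_mul]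
    exact DFunLike.congr_fun (mfderiv_id (I := 𝓘(ℝ, EG)) (x := (1 : G))) _
  refine (congrArg₂ (fun a b : EG ↦ a + b) e1 e2).trans (two_smul ℝ _).symm

theorem mem_lieAlgebraOf {H : Subgroup G} {X : EG} :
    (show GroupLieAlgebra 𝓘(ℝ, EG) G from X) ∈ lieAlgebraOf H ↔ ∃ c : ℝ → G, c 0 = 1 ∧
      (∀ᶠ s in 𝓝 (0 : ℝ), c s ∈ H) ∧ MDifferentiableAt 𝓘(ℝ, ℝ) 𝓘(ℝ, EG) c 0 ∧
      vel EG c 0 = X :=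
  ⟨fun ⟨c, h, h1, h2, h3⟩ ↦ ⟨c, h, h1, h2, (tangentCast_apply h (vel EG c 0)).symm.trans h3⟩,
    fun ⟨c, h, h1, h2, h3⟩ ↦ ⟨c, h, h1, h2, (tangentCast_apply h (vel EG c 0)).trans h3⟩⟩

/-- A local integral curve of the left-invariant field of `X`, in the role of `s ↦ exp(sX)`. Neither
completeness nor the homomorphism property is needed. -/
theorem exists_integralCurve (X : EG) : ∃ c : ℝ → G, c 0 = 1 ∧ ∀ᶠ s in 𝓝 (0 : ℝ),
    MDifferentiableAt 𝓘(ℝ, ℝ) 𝓘(ℝ, EG) c s ∧ vel EG c s = dmap EG EG (fun g ↦ c s * g) 1 X := by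
  have : LieGroup 𝓘(ℝ, EG) (minSmoothness ℝ 3) G := by
    rw [minSmoothness_of_isRCLikeNormedField]
    exact LieGroup.of_le (n := ∞) ENat.LEInfty.out
  have : IsManifold 𝓘(ℝ, EG) 1 G := IsManifold.of_le (n := ∞) ENat.LEInfty.out
  have : CompleteSpace EG := FiniteDimensional.complete ℝ EG
  have hX := contMDiffAt_mulInvariantVectorField (I := 𝓘(ℝ, EG)) (G := G)
    (show GroupLieAlgebra 𝓘(ℝ, EG) G from X) (g := 1)
  obtain ⟨c, h0, hc⟩ := exists_isMIntegralCurveAt_of_contMDiffAt_boundaryless (t₀ := (0 : ℝ))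
    (hX.of_le (by rw [minSmoothness_of_isRCLikeNormedField]; norm_num))
  refine ⟨c, h0, hc.mono fun s hs ↦ ⟨hs.mdifferentiableAt, ?_⟩⟩
  refine (DFunLike.congr_fun hs.mfderiv (1 : ℝ)).trans (one_smul ℝ _)

end LieGroup

section Action
variable {EG : Type*} [NormedAddCommGroup EG] [NormedSpace ℝ EG] [FiniteDimensional ℝ EG]
  {G : Type*} [TopologicalSpace G] [ChartedSpace EG G] [Group G] [LieGroup 𝓘(ℝ, EG) ∞ G]
  {E : Type*} [NormedAddCommGroup E] [NormedSpace ℝ E] [FiniteDimensional ℝ E]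
  {M : Type*} [TopologicalSpace M] [ChartedSpace E M] [IsManifold 𝓘(ℝ, E) ∞ M]
  [MulAction G M]

variable (EG G E) in
/-- The action field, as a linear map between the model spaces. -/
def act (p : M) : EG →L[ℝ] E := dmap EG E (fun g : G ↦ g • p) 1

theorem actionField_eq_act (p : M) (X : EG) :
    (actionField EG E p (show GroupLieAlgebra 𝓘(ℝ, EG) G from X) : E) = act EG G E p X :=
  tangentCast_apply (one_smul G p) (act EG G E p X)

variable (hs : ContMDiffSMul 𝓘(ℝ, EG) 𝓘(ℝ, E) ∞ G M)
include hs

theorem contMDiff_smul_const (p : M) : ContMDiff 𝓘(ℝ, EG) 𝓘(ℝ, E) ∞ (fun g : G ↦ g • p) :=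
  (contMDiff_smul (I := 𝓘(ℝ, EG)) (I' := 𝓘(ℝ, E)) (n := ∞)).comp
    (contMDiff_id.prodMk contMDiff_const)

theorem contMDiff_smulLeft (g : G) : ContMDiff 𝓘(ℝ, E) 𝓘(ℝ, E) ∞ (fun p : M ↦ g • p) :=
  (contMDiff_smul (I := 𝓘(ℝ, EG)) (I' := 𝓘(ℝ, E)) (n := ∞)).comp
    (contMDiff_const.prodMk contMDiff_id)

theorem vel_smul {c : ℝ → G} {s : ℝ} (hc : MDifferentiableAt 𝓘(ℝ, ℝ) 𝓘(ℝ, EG) c s) (p : M) :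
    vel E (fun σ ↦ c σ • p) s = dmap EG E (fun g : G ↦ g • p) (c s) (vel EG c s) :=
  vel_comp ((contMDiff_smul_const hs p).mdifferentiable (by simp) _) hc

theorem vel_smul_of_eq_one {c : ℝ → G} {s : ℝ} (hc : MDifferentiableAt 𝓘(ℝ, ℝ) 𝓘(ℝ, EG) c s)
    (h1 : c s = 1) (p : M) : vel E (fun σ ↦ c σ • p) s = act EG G E p (vel EG c s) := by
  rw [vel_smul hs hc, h1]; rfl

theorem dmap_smul_mul (g : G) (p : M) (X : EG) :
    dmap EG E (fun k : G ↦ (g * k) • p) 1 X = dmap E E (fun q : M ↦ g • q) p (act EG G E p X) := by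
  have h := dmap_comp (E := EG) (E' := E) (ψ := fun k : G ↦ k • p) (χ := fun q : M ↦ g • q) (p := 1)
    ((contMDiff_smulLeft hs g).mdifferentiable (by simp) _)
    ((contMDiff_smul_const hs p).mdifferentiable (by simp) _) X
  rw [one_smul] at h
  simpa only [Function.comp_def, smul_smul, act] using h

/-- Velocities inside an orbit are translates of action fields: `X` is `v` moved back to the
identity by left translation. -/
theorem exists_dmap_smul_const (g : G) (p : M) (v : EG) :
    ∃ X, dmap EG E (fun k : G ↦ k • p) g v = dmap E E (fun q : M ↦ g • q) p (act EG G E p X) := by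
  refine ⟨dmap EG EG (fun k ↦ g⁻¹ * k) g v, ?_⟩
  have h := dmap_comp (E := EG) (E' := EG) (ψ := fun k : G ↦ g⁻¹ * k)
    (χ := fun k : G ↦ (g * k) • p) (p := g)
    (((contMDiff_smul_const hs p).comp (contMDiff_mul_left (a := g))).mdifferentiable (by simp) _)
    ((contMDiff_mul_left (a := g⁻¹)).mdifferentiable (n := ∞) (by simp) _) v
  rw [inv_mul_cancel, dmap_smul_mul hs] at h
  simpa only [Function.comp_def, mul_inv_cancel_left] using h

/-- The witness is `Y = Ad(g⁻¹) X`; only its existence is used. -/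
theorem exists_act_smul (g : G) (p : M) (X : EG) :
    ∃ Y, act EG G E (g • p) X = dmap E E (fun q : M ↦ g • q) p (act EG G E p Y) := by
  have h := dmap_comp (E := EG) (E' := EG) (ψ := fun k : G ↦ k * g)
    (χ := fun k : G ↦ k • p) (p := 1) ((contMDiff_smul_const hs p).mdifferentiable (by simp) _)
    ((contMDiff_mul_right (a := g)).mdifferentiable (n := ∞) (by simp) _) X
  rw [one_mul] at h
  obtain ⟨Y, hY⟩ := exists_dmap_smul_const hs g p (dmap EG EG (fun k ↦ k * g) 1 X)
  refine ⟨Y, ?_⟩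
  rw [← hY, ← h]
  simp only [Function.comp_def, mul_smul]
  rfl

theorem dmap_inv_smul (g : G) (p : M) (v : E) :
    dmap E E (fun q : M ↦ g⁻¹ • q) (g • p) (dmap E E (fun q : M ↦ g • q) p v) = v := by
  have h := dmap_comp (E := E) (E' := E) (ψ := fun q : M ↦ g • q) (χ := fun q : M ↦ g⁻¹ • q) (p := p)
    ((contMDiff_smulLeft hs g⁻¹).mdifferentiable (by simp) _)
    ((contMDiff_smulLeft hs g).mdifferentiable (by simp) _) v
  rw [← h]
  simp only [Function.comp_def, inv_smul_smul]
  exact DFunLike.congr_fun (mfderiv_id (I := 𝓘(ℝ, E)) (x := p)) _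

theorem exists_dmap_smul_act (g : G) (p : M) (Y : EG) :
    ∃ X, dmap E E (fun q : M ↦ g • q) p (act EG G E p Y) = act EG G E (g • p) X := by
  obtain ⟨X, hX⟩ := exists_act_smul hs g⁻¹ (g • p) Y
  refine ⟨X, ?_⟩
  rw [inv_smul_smul] at hX
  have := dmap_inv_smul hs g⁻¹ (g • p) (act EG G E (g • p) X)
  rwa [← hX, inv_inv, inv_smul_smul] at this

theorem act_vel_eq_zero {c : ℝ → G} (h1 : c 0 = 1)
    (hc : MDifferentiableAt 𝓘(ℝ, ℝ) 𝓘(ℝ, EG) c 0) {p : M} (h : ∀ᶠ s in 𝓝 (0 : ℝ), c s • p = p) :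
    act EG G E p (vel EG c 0) = 0 := by
  rw [← vel_smul_of_eq_one hs hc h1]
  have e : (fun σ ↦ c σ • p) =ᶠ[𝓝 0] fun _ ↦ p := h
  have := e.mfderiv_eq (I := 𝓘(ℝ, ℝ)) (I' := 𝓘(ℝ, E))
  exact (DFunLike.congr_fun this (1 : ℝ)).trans
    (DFunLike.congr_fun (mfderiv_const (I := 𝓘(ℝ, ℝ)) (I' := 𝓘(ℝ, E)) (c := p)) (1 : ℝ))

/-- The kernel of the action field at `p` consists of velocities of curves in the isotropy group. -/
theorem exists_curve_of_act_eq_zero {p : M} {X : EG} (hX : act EG G E p X = 0) :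
    ∃ c : ℝ → G, c 0 = 1 ∧ (∀ᶠ s in 𝓝 (0 : ℝ), c s • p = p) ∧
      MDifferentiableAt 𝓘(ℝ, ℝ) 𝓘(ℝ, EG) c 0 ∧ vel EG c 0 = X := by
  obtain ⟨c, h0, hc⟩ := exists_integralCurve (G := G) X
  refine ⟨c, h0, ?_, hc.self_of_nhds.1, ?_⟩
  -- Since `c'(s)` is the left translate of `X`, the velocity of `c(s) • p` is the image of `X*_p =
  -- 0` under the differential of `c(s)`. The orbit curve is therefore locally constant.
  · have hv : ∀ᶠ s in 𝓝 (0 : ℝ), vel E (fun σ ↦ c σ • p) s = 0 := by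
      filter_upwards [hc] with s hs'
      have h := dmap_comp (E := EG) (E' := EG) (ψ := fun k : G ↦ c s * k)
        (χ := fun k : G ↦ k • p) (p := 1) ((contMDiff_smul_const hs p).mdifferentiable (by simp) _)
        ((contMDiff_mul_left (a := c s)).mdifferentiable (n := ∞) (by simp) _) X
      rw [vel_smul hs hs'.1, hs'.2]
      rw [mul_one] at h
      rw [← h]
      exact (dmap_smul_mul hs (c s) p X).trans (by rw [hX, map_zero])
    have hx : ∀ᶠ s in 𝓝 (0 : ℝ), MDifferentiableAt 𝓘(ℝ, ℝ) 𝓘(ℝ, E) (fun σ ↦ c σ • p) s :=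
      hc.mono fun s hs' ↦ ((contMDiff_smul_const hs p).mdifferentiable (by simp) (c s)).comp s hs'.1
    have hp : c 0 • p ∈ (chartAt E p).source := by rw [h0, one_smul]; exact mem_chart_source E p
    have hsrc := hx.self_of_nhds.continuousAt.eventually ((chartAt E p).open_source.mem_nhds hp)
    obtain ⟨ε, hε, hball⟩ := Metric.eventually_nhds_iff_ball.1 (hv.and (hx.and hsrc))
    filter_upwards [Metric.ball_mem_nhds 0 hε] with s hsε
    have hd (σ : ℝ) (hσ : σ ∈ Metric.ball 0 ε) : deriv (extChartAt 𝓘(ℝ, E) p ∘ fun σ ↦ c σ • p) σ = 0 := by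
      obtain ⟨a, b, d⟩ := hball σ hσ
      rw [← dchart_vel d b, a, map_zero]
    have hdiff : DifferentiableOn ℝ (extChartAt 𝓘(ℝ, E) p ∘ fun σ ↦ c σ • p) (Metric.ball 0 ε) := by
      intro σ hσ
      obtain ⟨a, b, d⟩ := hball σ hσ
      exact (((mdifferentiableAt_extChartAt (I := 𝓘(ℝ, E)) d).comp σ b).differentiableAt).differentiableWithinAt
    have h := Metric.isOpen_ball.is_const_of_deriv_eq_zero
      (convex_ball (0 : ℝ) ε).isPreconnected hdiff hd hsε (Metric.mem_ball_self hε)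
    refine (extChartAt 𝓘(ℝ, E) p).injOn (by rw [extChartAt_source]; exact (hball s hsε).2.2)
      (by rw [extChartAt_source]; exact mem_chart_source E p) ?_
    simpa [h0] using h
  · rw [hc.self_of_nhds.2, h0]
    simp only [one_mul]
    exact DFunLike.congr_fun (mfderiv_id (I := 𝓘(ℝ, EG)) (x := (1 : G))) _

end Action

/-! ### Principal orbits and isotropy along a normal geodesic. -/

section Linear
variable {E : Type*} [NormedAddCommGroup E] [NormedSpace ℝ E] [FiniteDimensional ℝ E]
  {M : Type*} [TopologicalSpace M] [ChartedSpace E M] [IsManifold 𝓘(ℝ, E) ∞ M]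
  [RiemannianBundle (fun p : M ↦ TangentSpace 𝓘(ℝ, E) p)]

/-- A vector perpendicular to a hyperplane is a multiple of the unit normal. -/
theorem eq_smul_of_perp {p : M} {W : Submodule ℝ E} (hW : Module.finrank ℝ W + 1 = Module.finrank ℝ E)
    {v w : E} (hv : met p v v = 1) (hvW : ∀ z ∈ W, met p v z = 0) (hwW : ∀ z ∈ W, met p w z = 0) :
    w = met p v w • v := by
  have hvn : v ∉ W := fun h ↦ one_ne_zero (hv.symm.trans (hvW v h))
  have htop : W ⊔ Submodule.span ℝ {v} = ⊤ :=
    Submodule.eq_top_of_finrank_eq ((Submodule.finrank_sup_span_singleton hvn).trans hW)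
  refine eq_of_met_eq (p := p) fun z ↦ ?_
  obtain ⟨a, ha, b, hb, rfl⟩ := Submodule.mem_sup.1 (htop ▸ Submodule.mem_top : z ∈ W ⊔ Submodule.span ℝ {v})
  obtain ⟨k, rfl⟩ := Submodule.mem_span_singleton.1 hb
  simp only [map_add, map_smul, smul_apply, hwW a ha, hvW a ha, hv, met_comm p w v, smul_eq_mul]
  ring

end Linear

section Action
variable {EG : Type*} [NormedAddCommGroup EG] [NormedSpace ℝ EG] [FiniteDimensional ℝ EG]
  {G : Type*} [TopologicalSpace G] [ChartedSpace EG G] [Group G] [LieGroup 𝓘(ℝ, EG) ∞ G]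
  {E : Type*} [NormedAddCommGroup E] [NormedSpace ℝ E] [FiniteDimensional ℝ E]
  {M : Type*} [TopologicalSpace M] [ChartedSpace E M] [IsManifold 𝓘(ℝ, E) ∞ M]
  [RiemannianBundle (fun p : M ↦ TangentSpace 𝓘(ℝ, E) p)]
  [IsContMDiffRiemannianBundle 𝓘(ℝ, E) ∞ E (fun p : M ↦ TangentSpace 𝓘(ℝ, E) p)]
  [MulAction G M]

theorem mdifferentiableAt_mul_self {c : ℝ → G} {t : ℝ}
    (hc : MDifferentiableAt 𝓘(ℝ, ℝ) 𝓘(ℝ, EG) c t) :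
    MDifferentiableAt 𝓘(ℝ, ℝ) 𝓘(ℝ, EG) (fun s ↦ c s * c s) t :=
  MDifferentiableAt.comp (f := fun s ↦ (c s, c s)) t
    ((contMDiff_mul 𝓘(ℝ, EG) ∞).mdifferentiable (by simp) _) (hc.prodMk hc)

theorem orbitTangent_eq_range (q : M) :
    @Eq (Submodule ℝ E) (orbitTangent EG G E q) (LinearMap.range (act EG G E q).toLinearMap) :=
  Submodule.ext fun _ ↦ ⟨fun ⟨X, hX⟩ ↦ ⟨X, (actionField_eq_act (EG := EG) (G := G) q X).symm.trans hX⟩,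
    fun ⟨X, hX⟩ ↦ ⟨X, (actionField_eq_act (EG := EG) (G := G) q X).trans hX⟩⟩

variable (h : IsCohomogeneityOne EG G E M)
include h

theorem IsCohomogeneityOne.isLocalIsometry (g : G) :
    IsLocalIsometry (E := E) (fun p : M ↦ g • p) :=
  ⟨contMDiff_smulLeft h.smooth g, fun p v w ↦ h.isometric g p v w⟩

theorem IsCohomogeneityOne.met_dmap (g : G) (p : M) (v w : E) :
    met (g • p) (dmap E E (fun p : M ↦ g • p) p v) (dmap E E (fun p : M ↦ g • p) p w) = met p v w :=
  (h.isLocalIsometry g).met_dmap p v w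

theorem IsCohomogeneityOne.finrank_range_act_smul (g : G) (p : M) :
    Module.finrank ℝ (LinearMap.range (act EG G E (g • p)).toLinearMap) =
      Module.finrank ℝ (LinearMap.range (act EG G E p).toLinearMap) := by
  have hinj : Function.Injective (dmap E E (fun p : M ↦ g • p) p).toLinearMap :=
    Function.LeftInverse.injective (g := dmap E E (fun q : M ↦ g⁻¹ • q) (g • p))
      (dmap_inv_smul h.smooth g p)
  rw [(Submodule.equivMapOfInjective _ hinj
    (LinearMap.range (act EG G E p).toLinearMap)).finrank_eq]
  suffices LinearMap.range (act EG G E (g • p)).toLinearMap =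
      (LinearMap.range (act EG G E p).toLinearMap).map
        (dmap E E (fun p : M ↦ g • p) p).toLinearMap by rw [this]
  ext w
  constructor
  · rintro ⟨X, rfl⟩
    obtain ⟨Y, hY⟩ := exists_act_smul h.smooth g p X
    exact ⟨_, ⟨Y, rfl⟩, hY.symm⟩
  · rintro ⟨_, ⟨Y, rfl⟩, rfl⟩
    obtain ⟨X, hX⟩ := exists_dmap_smul_act h.smooth g p Y
    exact ⟨X, hX.symm⟩

/-- A conjugate of the isotropy group of `p` lies in that of `q`, hence the kernels of the action
fields are nested, and rank–nullity reverses the inequality. -/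
theorem IsPrincipal.finrank_range_act_le {p : M} (hp : IsPrincipal G p) (q : M) :
    Module.finrank ℝ (LinearMap.range (act EG G E q).toLinearMap) ≤
      Module.finrank ℝ (LinearMap.range (act EG G E p).toLinearMap) := by
  obtain ⟨g, hg⟩ := hp q
  rw [← h.finrank_range_act_smul g p]
  have hker : LinearMap.ker (act EG G E (g • p)).toLinearMap ≤
      LinearMap.ker (act EG G E q).toLinearMap := by
    intro X hX
    obtain ⟨c, h0, hc, hd, rfl⟩ := exists_curve_of_act_eq_zero h.smooth (LinearMap.mem_ker.1 hX)
    exact act_vel_eq_zero h.smooth h0 hd (hc.mono fun s hs ↦ hg hs)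
  have h1 := LinearMap.finrank_range_add_finrank_ker (act EG G E (g • p)).toLinearMap
  have h2 := LinearMap.finrank_range_add_finrank_ker (act EG G E q).toLinearMap
  have h3 := Submodule.finrank_mono hker
  omega

/-- Principal orbits have maximal dimension; some orbit has codimension one and none has codimension
zero. -/
theorem IsPrincipal.finrank_range_act {p : M} (hp : IsPrincipal G p) :
    Module.finrank ℝ (LinearMap.range (act EG G E p).toLinearMap) + 1 = Module.finrank ℝ E := by
  have key (q : M) : Module.finrank ℝ (orbitTangent EG G E q) =
      Module.finrank ℝ (LinearMap.range (act EG G E q).toLinearMap) :=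
    congrArg (fun W : Submodule ℝ E ↦ Module.finrank ℝ W) (orbitTangent_eq_range q)
  obtain ⟨q, hq⟩ := h.exists_codim_one
  have h1 := h.codim_pos p
  have h2 := hp.finrank_range_act_le h q
  rw [key] at hq h1
  omega

variable {γ : ℝ → M} (hγ : IsNormalGeodesic EG G E γ)
include hγ

omit h in
theorem IsNormalGeodesic.met_vel_act (t : ℝ) (X : EG) :
    met (γ t) (vel E γ t) (act EG G E (γ t) X) = 0 := by
  rw [← actionField_eq_act]
  exact hγ.perpendicular t _ ⟨X, rfl⟩

omit h in
theorem IsNormalGeodesic.met_vel_vel (t : ℝ) : met (γ t) (vel E γ t) (vel E γ t) = 1 := by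
  have := real_inner_self_eq_norm_sq (velocity E γ t)
  rw [hγ.unit_speed, one_pow] at this
  exact this

/-- The square of an isotropy at a regular point of a normal geodesic fixes the geodesic. -/
theorem IsNormalGeodesic.mul_self_smul [T2Space M] {t : ℝ} (ht : IsPrincipal G (γ t)) {g : G}
    (hg : g • γ t = γ t) (u : ℝ) : (g * g) • γ u = γ u := by
  have hγs : ContMDiff 𝓘(ℝ, ℝ) 𝓘(ℝ, E) ∞ γ := hγ.geodesic.smooth
  set D := dmap E E (fun p : M ↦ g • p) (γ t) with hD
  have hmet (v w : E) : met (γ t) (D v) (D w) = met (γ t) v w := by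
    have := h.met_dmap g (γ t) v w
    rwa [hg] at this
  -- `g` fixes `γ t`, so `D` preserves the tangent space of the orbit and with it the normal space,
  -- a line because the orbit is principal.
  have hw : D (vel E γ t) = met (γ t) (vel E γ t) (D (vel E γ t)) • vel E γ t := by
    refine eq_smul_of_perp (ht.finrank_range_act h) (hγ.met_vel_vel t) ?_ ?_
    · rintro _ ⟨X, rfl⟩
      exact hγ.met_vel_act t X
    · rintro _ ⟨X, rfl⟩
      obtain ⟨Y, hY⟩ := exists_act_smul h.smooth g (γ t) X
      rw [hg] at hY
      refine (congrArg _ hY).trans ?_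
      rw [← hD, hmet]
      exact hγ.met_vel_act t Y
  set a := met (γ t) (vel E γ t) (D (vel E γ t))
  -- `D` is an isometry, so `a = ±1`. The sign is left undetermined, which is why the square of `g`
  -- is used.
  have ha : a * a = 1 := by
    have := hmet (vel E γ t) (vel E γ t)
    rw [hw, hγ.met_vel_vel] at this
    simpa [hγ.met_vel_vel] using this
  have hDD : D (D (vel E γ t)) = vel E γ t := by
    rw [hw, map_smul, hw, smul_smul, ha, one_smul]
  have hmd (g : G) (p : M) : MDifferentiableAt 𝓘(ℝ, E) 𝓘(ℝ, E) (fun p : M ↦ g • p) p :=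
    (contMDiff_smulLeft h.smooth g).mdifferentiable (by simp) p
  have hvel : vel E (fun u ↦ (g * g) • γ u) t = vel E γ t := by
    have h1 := vel_comp (ψ := fun p : M ↦ (g * g) • p) (x := γ) (t := t) (hmd _ _)
      (hγs.mdifferentiable (by simp) t)
    have h2 := dmap_comp (ψ := fun p : M ↦ g • p) (χ := fun p : M ↦ g • p) (p := γ t)
      (hmd _ _) (hmd _ _) (vel E γ t)
    rw [hg, ← hD, hDD] at h2
    refine h1.trans (Eq.trans ?_ h2)
    simp only [mul_smul]
    rfl
  have hext : IsExtremal E γ := hγ.geodesic.isExtremal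
  have hext2 : IsExtremal E (fun u ↦ (g * g) • γ u) := by
    refine IsExtremal.of_comp (h.isLocalIsometry (g * g)⁻¹)
      (((contMDiff_smulLeft h.smooth (g * g)).comp hγs).of_le two_le_infty) ?_
    simpa only [Function.comp_def, inv_smul_smul] using hext
  exact congrFun (hext2.eq hext (t := t) (by simp only [mul_smul, hg]) hvel) u

/-- A curve of isotropies at `γ t` with velocity `X`, squared pointwise, fixes `γ u` and has
velocity `2 X`. -/
theorem IsNormalGeodesic.act_eq_zero [T2Space M] {t : ℝ} (ht : IsPrincipal G (γ t)) {X : EG}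
    (hX : (show GroupLieAlgebra 𝓘(ℝ, EG) G from X) ∈ lieAlgebraOf (MulAction.stabilizer G (γ t)))
    (u : ℝ) : act EG G E (γ u) X = 0 := by
  obtain ⟨c, h0, hc, hd, rfl⟩ := mem_lieAlgebraOf.1 hX
  have h2 : act EG G E (γ u) (vel EG (fun s ↦ c s * c s) 0) = 0 :=
    act_vel_eq_zero h.smooth (by simp [h0]) (mdifferentiableAt_mul_self hd)
      (hc.mono fun s hs ↦ hγ.mul_self_smul h ht hs u)
  rw [vel_mul_self h0 hd, map_smul] at h2
  exact (smul_eq_zero.1 h2).resolve_left two_ne_zero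

theorem IsNormalGeodesic.two_smul_mem_lieAlgebraOf [T2Space M] {t : ℝ} (ht : IsPrincipal G (γ t))
    {X : EG} (hX : act EG G E (γ t) X = 0) (u : ℝ) :
    (show GroupLieAlgebra 𝓘(ℝ, EG) G from (2 : ℝ) • X) ∈
      lieAlgebraOf (MulAction.stabilizer G (γ u)) := by
  obtain ⟨c, h0, hc, hd, rfl⟩ := exists_curve_of_act_eq_zero h.smooth hX
  exact mem_lieAlgebraOf.2 ⟨fun s ↦ c s * c s, by simp [h0],
    hc.mono fun s hs ↦ hγ.mul_self_smul h ht hs u, mdifferentiableAt_mul_self hd, vel_mul_self h0 hd⟩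

/-- Injectivity of the action field on `𝔫` at regular points: `2 X` lies in the Lie algebra of the
isotropy group at `γ s`, so `Q(2X, X) = 0`. -/
theorem IsNormalGeodesic.eq_zero_of_mem_complement [T2Space M] {t s : ℝ}
    (ht : IsPrincipal G (γ t)) {Q : BiinvariantMetric EG G} {X : EG}
    (hXQ : X ∈ complement Q (MulAction.stabilizer G (γ s)))
    (hX : act EG G E (γ t) X = 0) : X = 0 := by
  by_contra hne
  have h1 := hXQ _ (hγ.two_smul_mem_lieAlgebraOf h ht hX s)
  have h2 := Q.pos X hne
  have h3 : Q.form ((2 : ℝ) • X) X = 2 * Q.form X X :=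
    (LinearMap.congr_fun (map_smul Q.form (2 : ℝ) X) X).trans rfl
  linarith [h3.symm.trans h1]

/-- Removing from `X` its part in the isotropy algebra changes no action field along `γ`.
`lieAlgebraOf` is only a set, so the splitting uses its span, which has the same orthogonal
complement. -/
theorem IsNormalGeodesic.exists_mem_complement [T2Space M] {s : ℝ}
    (hs : IsPrincipal G (γ s)) (Q : BiinvariantMetric EG G) (X : EG) :
    ∃ Y : complement Q (MulAction.stabilizer G (γ s)),
      ∀ u, act EG G E (γ u) X = act EG G E (γ u) (Y : GroupLieAlgebra 𝓘(ℝ, EG) G) := by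
  set W : Submodule ℝ (GroupLieAlgebra 𝓘(ℝ, EG) G) :=
    Submodule.span ℝ (lieAlgebraOf (MulAction.stabilizer G (γ s)))
  have hcompl : IsCompl W (Q.form.orthogonal W) := by
    refine LinearMap.BilinForm.isCompl_orthogonal_of_restrict_nondegenerate ?_
      (restrict_nondegenerate Q W)
    intro X Y h
    rw [Q.symm]; exact h
  obtain ⟨A, hA, Y, hY, hAY⟩ := Submodule.mem_sup.1
    (hcompl.sup_eq_top ▸ Submodule.mem_top : (show GroupLieAlgebra 𝓘(ℝ, EG) G from X) ∈ _)
  refine ⟨⟨Y, fun Z hZ ↦ hY Z (Submodule.subset_span hZ)⟩, fun u ↦ ?_⟩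
  have hW : W ≤ LinearMap.ker (act EG G E (γ u)).toLinearMap :=
    Submodule.span_le.2 fun Z hZ ↦ hγ.act_eq_zero h hs hZ u
  have h1 : act EG G E (γ u) A = 0 := hW hA
  have h2 := (act EG G E (γ u)).map_add A Y
  rw [h1, zero_add] at h2
  exact (congrArg _ hAY.symm).trans h2

end Action

/-! ### Metric endomorphisms and derivatives of Gram matrices. -/

section Linear
variable {V : Type*} [AddCommGroup V] [Module ℝ V] [FiniteDimensional ℝ V]

/-- Each matrix entry of `P s` is `B X (P s Y)` with `X` the `B`-dual of a coordinate functional. So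
the entrywise derivative exists and is compatible with `B`. -/
theorem hasDerivAt_form_endoDeriv {B : LinearMap.BilinForm ℝ V} (hB : B.Nondegenerate)
    {P : ℝ → Module.End ℝ V} {t : ℝ} (hP : ∀ X Y, DifferentiableAt ℝ (fun s ↦ B X (P s Y)) t)
    (X Y : V) : HasDerivAt (fun s ↦ B X (P s Y)) (B X (endoDeriv P t Y)) t := by
  set b := Module.finBasis ℝ V
  have hM (i j) : HasDerivAt (fun s ↦ LinearMap.toMatrix b b (P s) i j)
      (deriv (fun s ↦ LinearMap.toMatrix b b (P s) i j) t) t := by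
    refine DifferentiableAt.hasDerivAt ?_
    have h1 := hP ((B.toDual hB).symm (b.coord i)) (b j)
    refine h1.congr_of_eventuallyEq (Filter.Eventually.of_forall fun s ↦ ?_)
    have h2 : B ((B.toDual hB).symm (b.coord i)) = b.coord i :=
      (B.toDual hB).apply_symm_apply (b.coord i)
    simp only [h2, LinearMap.toMatrix_apply, Module.Basis.coord_apply]
  have hexp (A : Matrix _ _ ℝ) : B X (Matrix.toLin b b A Y) =
      ∑ i, (∑ j, A i j * b.repr Y j) * B X (b i) := by
    rw [Matrix.toLin_apply, map_sum]
    simp only [map_smul, smul_eq_mul, Matrix.mulVec, dotProduct]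
  have h3 : (fun s ↦ B X (P s Y)) =
      fun s ↦ ∑ i, (∑ j, LinearMap.toMatrix b b (P s) i j * b.repr Y j) * B X (b i) := by
    funext s
    rw [← hexp, Matrix.toLin_toMatrix]
  rw [h3, endoDeriv, hexp]
  exact HasDerivAt.fun_sum fun i _ ↦ (HasDerivAt.fun_sum fun j _ ↦ (hM i j).mul_const _).mul_const _

/-- Coordinates in a `g`-orthonormal basis are `g (b i) Z = B (b i) (P Z)`. For `Z = P⁻¹ D (b j)`
the factor `P` cancels. -/
theorem toMatrix_eq_of_orthonormal {ι : Type*} [Fintype ι] [DecidableEq ι] {g g' : V → V → ℝ}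
    {B : LinearMap.BilinForm ℝ V} {P D : Module.End ℝ V} (hP : ∀ X Y, B X (P Y) = g X Y)
    (hD : ∀ X Y, B X (D Y) = g' X Y) (hg : ∀ Y, g Y Y = 0 → Y = 0) (b : Module.Basis ι ℝ V)
    (hb : ∀ i j, g (b i) (b j) = if i = j then 1 else 0) (i j : ι) :
    LinearMap.toMatrix b b (Ring.inverse P * D) i j = g' (b i) (b j) := by
  -- Definiteness of `g` makes `P` a unit, so `Ring.inverse P` is the true inverse and not the
  -- default value `0`.
  have hu : IsUnit P := (LinearMap.isUnit_iff_ker_eq_bot P).2 <| LinearMap.ker_eq_bot'.2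
    fun Y hY ↦ hg Y (by rw [← hP, hY, map_zero])
  have h1 : P (Ring.inverse P (D (b j))) = D (b j) :=
    LinearMap.congr_fun (Ring.mul_inverse_cancel P hu) (D (b j))
  have h2 : B (b i) (P (Ring.inverse P (D (b j)))) = g' (b i) (b j) := by rw [h1, hD]
  rw [← b.sum_repr (Ring.inverse P (D (b j)))] at h2
  simp only [map_sum, map_smul, hP, hb, smul_eq_mul, mul_ite, mul_one, mul_zero, Finset.sum_ite_eq,
    Finset.mem_univ, if_true] at h2
  rw [LinearMap.toMatrix_apply, ← h2]
  rfl

end Linear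

section Chart
variable {E : Type*} [NormedAddCommGroup E] [NormedSpace ℝ E] [FiniteDimensional ℝ E]
  {M : Type*} [TopologicalSpace M] [ChartedSpace E M] [IsManifold 𝓘(ℝ, E) ∞ M]

theorem exists_curve_vel_eq (p : M) (v : E) : ∃ c : ℝ → M, c 0 = p ∧
    ContMDiffAt 𝓘(ℝ, ℝ) 𝓘(ℝ, E) ∞ c 0 ∧ vel E c 0 = v := by
  let l : ℝ → E := fun s ↦ extChartAt 𝓘(ℝ, E) p p + s • v
  have hl0 : l 0 = extChartAt 𝓘(ℝ, E) p p := by simp [l]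
  have hl : ContDiff ℝ ∞ l := contDiff_const.add (contDiff_id.smul contDiff_const)
  have h0 : (extChartAt 𝓘(ℝ, E) p).symm (l 0) = p := by rw [hl0]; exact extChartAt_to_inv p
  have hc : ContMDiffAt 𝓘(ℝ, ℝ) 𝓘(ℝ, E) ∞ (fun s ↦ (extChartAt 𝓘(ℝ, E) p).symm (l s)) 0 := by
    refine ContMDiffAt.comp (f := l) 0 ?_ hl.contMDiff.contMDiffAt
    refine (contMDiffOn_extChartAt_symm p).contMDiffAt ((isOpen_extChartAt_target p).mem_nhds ?_)
    rw [hl0]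
    exact mem_extChartAt_target p
  refine ⟨_, h0, hc, ?_⟩
  have h := dchart_vel (p := p) (by rw [h0]; exact mem_chart_source E p) (hc.mdifferentiableAt (by simp))
  rw [h0, dchart_self] at h
  refine h.trans ?_
  have hev : extChartAt 𝓘(ℝ, E) p ∘ (fun s ↦ (extChartAt 𝓘(ℝ, E) p).symm (l s)) =ᶠ[𝓝 0] l := by
    filter_upwards [hl.continuous.continuousAt.eventually ((isOpen_extChartAt_target p).mem_nhds
      (show l 0 ∈ _ by rw [hl0]; exact mem_extChartAt_target p))] with s hs
    exact (extChartAt 𝓘(ℝ, E) p).right_inv hs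
  rw [hev.deriv_eq]
  simpa [l] using (((hasDerivAt_id (0 : ℝ)).smul_const v).const_add (extChartAt 𝓘(ℝ, E) p p)).deriv

variable [RiemannianBundle (fun p : M ↦ TangentSpace 𝓘(ℝ, E) p)]
  [IsContMDiffRiemannianBundle 𝓘(ℝ, E) ∞ E (fun p : M ↦ TangentSpace 𝓘(ℝ, E) p)]

theorem differentiableAt_met_slice {f : ℝ → ℝ → M} {s u : ℝ}
    (hf : ContMDiffAt 𝓘(ℝ, ℝ × ℝ) 𝓘(ℝ, E) 2 (fun z : ℝ × ℝ ↦ f z.1 z.2) (s, u)) :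
    DifferentiableAt ℝ (fun υ ↦ met (f s υ) (vel E (fun σ ↦ f σ υ) s) (vel E (fun σ ↦ f σ υ) s)) u := by
  obtain ⟨hy, hev⟩ := eventually_dchart_slices (mem_chart_source E (f s u)) hf
  have hr := ((Continuous.prodMk_right s).tendsto u).eventually hev
  have hd := (hasDerivAt_slice_right
    ((hy.fderiv_right (m := 1) (by norm_num)).differentiableAt (by simp))).clm_apply
    (hasDerivAt_const u ((1 : ℝ), (0 : ℝ)))
  have hg : DifferentiableAt ℝ (fun υ ↦ chartMetric (f s u) (extChartAt 𝓘(ℝ, E) (f s u) (f s υ))) u :=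
    DifferentiableAt.comp (g := chartMetric (f s u)) u
      ((contDiffAt_chartMetric (mem_extChartAt_target (f s u))).differentiableAt (by simp))
      (hasDerivAt_slice_right (hy.differentiableAt (by simp))).differentiableAt
  refine ((hg.clm_apply hd.differentiableAt).clm_apply hd.differentiableAt).congr_of_eventuallyEq ?_
  filter_upwards [hr] with υ hυ
  rw [met_eq_chartMetric hυ.1, hυ.2.1]

end Chart

section Action
variable {EG : Type*} [NormedAddCommGroup EG] [NormedSpace ℝ EG] [FiniteDimensional ℝ EG]
  {G : Type*} [TopologicalSpace G] [ChartedSpace EG G] [Group G] [LieGroup 𝓘(ℝ, EG) ∞ G]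
  {E : Type*} [NormedAddCommGroup E] [NormedSpace ℝ E] [FiniteDimensional ℝ E]
  {M : Type*} [TopologicalSpace M] [ChartedSpace E M] [IsManifold 𝓘(ℝ, E) ∞ M]
  [MulAction G M]

theorem contMDiffAt_smul_slices (hs : ContMDiffSMul 𝓘(ℝ, EG) 𝓘(ℝ, E) ∞ G M)
    {c : ℝ → G} {x : ℝ → M} {s u : ℝ}
    (hc : ContMDiffAt 𝓘(ℝ, ℝ) 𝓘(ℝ, EG) ∞ c s) (hx : ContMDiffAt 𝓘(ℝ, ℝ) 𝓘(ℝ, E) ∞ x u) :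
    ContMDiffAt 𝓘(ℝ, ℝ × ℝ) 𝓘(ℝ, E) 2 (fun z : ℝ × ℝ ↦ c z.1 • x z.2) (s, u) := by
  have h1 : ContMDiffAt 𝓘(ℝ, ℝ × ℝ) 𝓘(ℝ, EG) ∞ (fun z : ℝ × ℝ ↦ c z.1) (s, u) :=
    ContMDiffAt.comp (f := Prod.fst) (s, u) hc contDiffAt_fst.contMDiffAt
  have h2 : ContMDiffAt 𝓘(ℝ, ℝ × ℝ) 𝓘(ℝ, E) ∞ (fun z : ℝ × ℝ ↦ x z.2) (s, u) :=
    ContMDiffAt.comp (f := Prod.snd) (s, u) hx contDiffAt_snd.contMDiffAt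
  exact (ContMDiffAt.comp (s, u) (contMDiff_smul (I := 𝓘(ℝ, EG)) (I' := 𝓘(ℝ, E)) (n := ∞)).contMDiffAt
    (h1.prodMk h2)).of_le two_le_infty

variable [RiemannianBundle (fun p : M ↦ TangentSpace 𝓘(ℝ, E) p)]
  [IsContMDiffRiemannianBundle 𝓘(ℝ, E) ∞ E (fun p : M ↦ TangentSpace 𝓘(ℝ, E) p)]

theorem differentiableAt_met_act_self (hs : ContMDiffSMul 𝓘(ℝ, EG) 𝓘(ℝ, E) ∞ G M)
    {γ : ℝ → M} {t : ℝ} (hγ : ContMDiffAt 𝓘(ℝ, ℝ) 𝓘(ℝ, E) ∞ γ t) (X : EG) :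
    DifferentiableAt ℝ (fun s ↦ met (γ s) (act EG G E (γ s) X) (act EG G E (γ s) X)) t := by
  obtain ⟨c, h0, hc, rfl⟩ := exists_curve_vel_eq (1 : G) X
  have h := differentiableAt_met_slice (f := fun σ υ ↦ c σ • γ υ) (contMDiffAt_smul_slices hs hc hγ)
  simp only [vel_smul_of_eq_one hs (hc.mdifferentiableAt (by simp)) h0, h0, one_smul] at h
  exact h

/-- Polarization of the quadratic case. -/
theorem differentiableAt_met_act (hs : ContMDiffSMul 𝓘(ℝ, EG) 𝓘(ℝ, E) ∞ G M)
    {γ : ℝ → M} {t : ℝ} (hγ : ContMDiffAt 𝓘(ℝ, ℝ) 𝓘(ℝ, E) ∞ γ t) (X Y : EG) :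
    DifferentiableAt ℝ (fun s ↦ met (γ s) (act EG G E (γ s) X) (act EG G E (γ s) Y)) t := by
  have h := (((differentiableAt_met_act_self hs hγ (X + Y)).sub
    (differentiableAt_met_act_self hs hγ X)).sub
    (differentiableAt_met_act_self hs hγ Y)).const_mul (1 / 2 : ℝ)
  refine h.congr_of_eventuallyEq (Filter.Eventually.of_forall fun s ↦ ?_)
  simp only [Pi.sub_apply, map_add, add_apply, met_comm (γ s) (act EG G E (γ s) Y) (act EG G E (γ s) X)]
  ring

variable (h : IsCohomogeneityOne EG G E M) {γ : ℝ → M} (hγ : IsNormalGeodesic EG G E γ)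
include h hγ

omit h hγ in
theorem form_metricEndo (Q : BiinvariantMetric EG G)
    (n : Submodule ℝ (GroupLieAlgebra 𝓘(ℝ, EG) G)) (s : ℝ) (X Y : n) :
    Q.form.restrict n X (metricEndo E Q n γ s Y) =
      met (γ s) (act EG G E (γ s) (X : GroupLieAlgebra 𝓘(ℝ, EG) G))
        (act EG G E (γ s) (Y : GroupLieAlgebra 𝓘(ℝ, EG) G)) :=
  (metricEndo_spec Q n γ s X Y).trans
    (congrArg₂ (fun a b ↦ met (E := E) (γ s) a b) (actionField_eq_act _ _) (actionField_eq_act _ _))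

/-- The derivative of the metric endomorphism represents the derivative of the metric. -/
theorem form_endoDeriv_metricEndo (Q : BiinvariantMetric EG G)
    (n : Submodule ℝ (GroupLieAlgebra 𝓘(ℝ, EG) G)) (t : ℝ) (X Y : n) :
    Q.form.restrict n X (endoDeriv (metricEndo E Q n γ) t Y) =
      deriv (fun s ↦ met (γ s) (act EG G E (γ s) (X : GroupLieAlgebra 𝓘(ℝ, EG) G))
        (act EG G E (γ s) (Y : GroupLieAlgebra 𝓘(ℝ, EG) G))) t := by
  have hd := hasDerivAt_form_endoDeriv (restrict_nondegenerate Q n) (P := metricEndo E Q n γ) (t := t)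
    (fun X Y ↦ by
      simp only [form_metricEndo]
      exact differentiableAt_met_act h.smooth hγ.geodesic.smooth.contMDiffAt _ _) X Y
  simp only [form_metricEndo] at hd
  exact hd.deriv.symm

variable [T2Space M]

/-- The matrix of `P_t⁻¹ P'_r` in a basis that is orthonormal at `γ t`. -/
theorem toMatrix_metricEndo {t s : ℝ} (ht : IsPrincipal G (γ t)) (Q : BiinvariantMetric EG G) (r : ℝ)
    {ι : Type*} [Fintype ι] [DecidableEq ι]
    (b : Module.Basis ι ℝ (complement Q (MulAction.stabilizer G (γ s))))
    (hb : ∀ i j, met (γ t) (act EG G E (γ t) (b i : GroupLieAlgebra 𝓘(ℝ, EG) G))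
      (act EG G E (γ t) (b j : GroupLieAlgebra 𝓘(ℝ, EG) G)) = if i = j then 1 else 0) (i j : ι) :
    LinearMap.toMatrix b b (Ring.inverse
      (metricEndo E Q (complement Q (MulAction.stabilizer G (γ s))) γ t) *
        endoDeriv (metricEndo E Q (complement Q (MulAction.stabilizer G (γ s))) γ) r) i j =
      deriv (fun s ↦ met (γ s) (act EG G E (γ s) (b i : GroupLieAlgebra 𝓘(ℝ, EG) G))
        (act EG G E (γ s) (b j : GroupLieAlgebra 𝓘(ℝ, EG) G))) r :=
  toMatrix_eq_of_orthonormal (form_metricEndo Q _ t) (form_endoDeriv_metricEndo h hγ Q _ r)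
    (fun Y hY ↦ Subtype.ext (hγ.eq_zero_of_mem_complement h ht Y.2 (met_self_eq_zero.1 hY))) b hb i j

/-- The `e i` need not lie in `𝔫`. Their components `Y i` in `𝔫` have the same action fields along
the whole of `γ` and form a basis of `𝔫` that is orthonormal at time `t`. -/
theorem trace_metricEndo {t s : ℝ} (ht : IsPrincipal G (γ t)) (hs : IsPrincipal G (γ s))
    (Q : BiinvariantMetric EG G) (r : ℝ) {ι : Type*} [Fintype ι] [DecidableEq ι] {e : ι → EG}
    (he : ∀ i j, met (γ t) (act EG G E (γ t) (e i)) (act EG G E (γ t) (e j)) = if i = j then 1 else 0)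
    (hspan : ∀ X, ∃ a : ι → ℝ, act EG G E (γ t) X = ∑ i, a i • act EG G E (γ t) (e i)) :
    LinearMap.trace ℝ _ (Ring.inverse
      (metricEndo E Q (complement Q (MulAction.stabilizer G (γ s))) γ t) *
        endoDeriv (metricEndo E Q (complement Q (MulAction.stabilizer G (γ s))) γ) r) =
      ∑ i, deriv (fun s ↦ met (γ s) (act EG G E (γ s) (e i)) (act EG G E (γ s) (e i))) r := by
  choose Y hY using fun i ↦ hγ.exists_mem_complement h hs Q (e i)
  have hinj (Z : complement Q (MulAction.stabilizer G (γ s)))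
      (hZ : act EG G E (γ t) (Z : GroupLieAlgebra 𝓘(ℝ, EG) G) = 0) : Z = 0 :=
    Subtype.ext (hγ.eq_zero_of_mem_complement h ht Z.2 hZ)
  let L : complement Q (MulAction.stabilizer G (γ s)) →ₗ[ℝ] E :=
    (act EG G E (γ t)).toLinearMap ∘ₗ (complement Q (MulAction.stabilizer G (γ s))).subtype
  have hL (i) : L (Y i) = act EG G E (γ t) (e i) := (hY i t).symm
  have hli : LinearIndependent ℝ Y := by
    refine Fintype.linearIndependent_iff.2 fun a ha i ↦ ?_
    have h1 : ∑ j, a j • L (Y j) = 0 := by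
      rw [← map_zero L, ← ha, map_sum]
      simp only [map_smul]
    simp only [hL] at h1
    have h2 := congrArg (met (γ t) (act EG G E (γ t) (e i))) h1
    simpa [he] using h2
  have hsp : ⊤ ≤ Submodule.span ℝ (Set.range Y) := by
    intro Z _
    obtain ⟨a, ha⟩ := hspan (Z : GroupLieAlgebra 𝓘(ℝ, EG) G)
    have h1 : L (Z - ∑ i, a i • Y i) = 0 := by
      rw [map_sub, map_sum]
      simp only [map_smul, hL, ← ha]
      exact sub_self _
    rw [sub_eq_zero.1 (hinj _ h1)]
    exact Submodule.sum_mem _ fun i _ ↦ Submodule.smul_mem _ _ (Submodule.subset_span ⟨i, rfl⟩)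
  have hb (i) : Module.Basis.mk hli hsp i = Y i := Module.Basis.mk_apply hli hsp i
  rw [LinearMap.trace_eq_matrix_trace ℝ (Module.Basis.mk hli hsp), Matrix.trace]
  refine Finset.sum_congr rfl fun i _ ↦ ?_
  rw [Matrix.diag_apply, toMatrix_metricEndo h hγ ht Q r _ (fun i j ↦ ?_)]
  · simp only [hb]
    simp only [← hY]
  · simp only [hb]
    rw [← hY, ← hY, he]

/-- The inner products with the basis at time `t` are the coordinates of the `𝔫`-component `Y` of
`X`. The double sum is thus `Q(Y, P'_r Y)`, which no longer involves `t`. -/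
theorem sum_mul_toMatrix_metricEndo {t s : ℝ} (ht : IsPrincipal G (γ t)) (hs : IsPrincipal G (γ s))
    (Q : BiinvariantMetric EG G) (r : ℝ) {ι : Type*} [Fintype ι] [DecidableEq ι]
    (b : Module.Basis ι ℝ (complement Q (MulAction.stabilizer G (γ s))))
    (hb : ∀ i j, met (γ t) (act EG G E (γ t) (b i : GroupLieAlgebra 𝓘(ℝ, EG) G))
      (act EG G E (γ t) (b j : GroupLieAlgebra 𝓘(ℝ, EG) G)) = if i = j then 1 else 0) (X : EG) :
    ∑ i, ∑ j, met (γ t) (act EG G E (γ t) X) (act EG G E (γ t) (b i : GroupLieAlgebra 𝓘(ℝ, EG) G)) *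
      met (γ t) (act EG G E (γ t) X) (act EG G E (γ t) (b j : GroupLieAlgebra 𝓘(ℝ, EG) G)) *
      LinearMap.toMatrix b b (Ring.inverse
      (metricEndo E Q (complement Q (MulAction.stabilizer G (γ s))) γ t) *
        endoDeriv (metricEndo E Q (complement Q (MulAction.stabilizer G (γ s))) γ) r) i j =
      deriv (fun s ↦ met (γ s) (act EG G E (γ s) X) (act EG G E (γ s) X)) r := by
  obtain ⟨Y, hY⟩ := hγ.exists_mem_complement h hs Q X
  let L : complement Q (MulAction.stabilizer G (γ s)) →ₗ[ℝ] E :=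
    (act EG G E (γ t)).toLinearMap ∘ₗ (complement Q (MulAction.stabilizer G (γ s))).subtype
  have hc (i) : met (γ t) (act EG G E (γ t) X)
      (act EG G E (γ t) (b i : GroupLieAlgebra 𝓘(ℝ, EG) G)) = b.repr Y i := by
    have h1 : act EG G E (γ t) X = ∑ j, b.repr Y j • L (b j) := by
      rw [hY]
      change L Y = _
      conv_lhs => rw [← b.sum_repr Y]
      simp only [map_sum, map_smul]
    have h2 (j) : met (γ t) (L (b j)) (act EG G E (γ t) (b i : GroupLieAlgebra 𝓘(ℝ, EG) G)) =
      if j = i then 1 else 0 := hb j i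
    rw [h1]
    simp [h2, sum_apply]
  simp only [hY, ← form_endoDeriv_metricEndo h hγ Q _ r Y Y]
  simp only [← hY, hc, toMatrix_metricEndo h hγ ht Q r b hb, ← form_endoDeriv_metricEndo h hγ Q _ r]
  conv_rhs => rw [← b.sum_repr Y]
  simp only [map_sum, map_smul, LinearMap.sum_apply, LinearMap.smul_apply, smul_eq_mul,
    Finset.mul_sum, mul_assoc]
  rw [Finset.sum_comm]
  refine Finset.sum_congr rfl fun i _ ↦ Finset.sum_congr rfl fun j _ ↦ ?_
  ring

end Action

/-! ### The normal component of the tension field. -/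

section Chart
variable {E : Type*} [NormedAddCommGroup E] [NormedSpace ℝ E] [FiniteDimensional ℝ E]
  {M : Type*} [TopologicalSpace M] [ChartedSpace E M] [IsManifold 𝓘(ℝ, E) ∞ M]

theorem vel_comp_real {x : ℝ → M} {r : ℝ → ℝ} {t : ℝ}
    (hx : MDifferentiableAt 𝓘(ℝ, ℝ) 𝓘(ℝ, E) x (r t)) (hr : DifferentiableAt ℝ r t) :
    vel E (x ∘ r) t = deriv r t • vel E x (r t) := by
  have h1 : vel E (x ∘ r) t = dmap ℝ E x (r t) (mfderiv 𝓘(ℝ, ℝ) 𝓘(ℝ, ℝ) r t (1 : ℝ)) :=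
    DFunLike.congr_fun (mfderiv_comp t hx hr.mdifferentiableAt) (1 : ℝ)
  rw [h1, mfderiv_eq_fderiv]
  have h2 : fderiv ℝ r t 1 = deriv r t • (1 : ℝ) := by simp
  exact (congrArg _ h2).trans (map_smul (dmap ℝ E x (r t)) (deriv r t) (1 : ℝ))

variable [RiemannianBundle (fun p : M ↦ TangentSpace 𝓘(ℝ, E) p)]
  [IsContMDiffRiemannianBundle 𝓘(ℝ, E) ∞ E (fun p : M ↦ TangentSpace 𝓘(ℝ, E) p)]

/-- The Christoffel term is quadratic in the velocity, so it scales by `r'²` together with the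
second derivative of the coordinates. -/
theorem acc_comp_real {x : ℝ → M} {r : ℝ → ℝ} {t : ℝ}
    (hx : ContMDiffAt 𝓘(ℝ, ℝ) 𝓘(ℝ, E) 2 x (r t)) (hr : ContDiffAt ℝ 2 r t) :
    (acc (x ∘ r) t : E) =
      deriv r t ^ 2 • acc x (r t) + deriv (deriv r) t • vel E x (r t) := by
  have hd := contDiffAt_extChartAt_comp (mem_chart_source E (x (r t))) hx
  have hv : deriv (extChartAt 𝓘(ℝ, E) (x (r t)) ∘ x) (r t) = vel E x (r t) := by
    rw [← dchart_vel (mem_chart_source E (x (r t))) (hx.mdifferentiableAt (by simp)), dchart_self]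
    rfl
  have h2 : deriv (deriv (extChartAt 𝓘(ℝ, E) (x (r t)) ∘ x ∘ r)) t =
      deriv r t ^ 2 • deriv (deriv (extChartAt 𝓘(ℝ, E) (x (r t)) ∘ x)) (r t) +
        deriv (deriv r) t • vel E x (r t) := by
    rw [← Function.comp_assoc, deriv_deriv_comp hd hr, ← hv]
    have h3 (a : ℝ) : fderiv ℝ (extChartAt 𝓘(ℝ, E) (x (r t)) ∘ x) (r t) a =
        a • deriv (extChartAt 𝓘(ℝ, E) (x (r t)) ∘ x) (r t) := by
      rw [← fderiv_apply_one_eq_deriv, ← map_smul, smul_eq_mul, mul_one]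
    have h4 : HasDerivAt (deriv (extChartAt 𝓘(ℝ, E) (x (r t)) ∘ x))
        (fderiv ℝ (fderiv ℝ (extChartAt 𝓘(ℝ, E) (x (r t)) ∘ x)) (r t) 1 1) (r t) := by
      have h5 : HasFDerivAt (fderiv ℝ (extChartAt 𝓘(ℝ, E) (x (r t)) ∘ x)) _ (r t) :=
        ((hd.fderiv_right (m := 1) (by norm_num)).differentiableAt (by simp)).hasFDerivAt
      simpa using h5.hasDerivAt.clm_apply (hasDerivAt_const (r t) (1 : ℝ))
    have h6 : deriv r t = deriv r t • (1 : ℝ) := by simp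
    rw [h3, h4.deriv, pow_two, mul_smul]
    conv_lhs => rw [h6]
    simp only [map_smul, smul_apply]
  rw [acc_eq (hx.comp t hr.contMDiffAt), acc_eq hx]
  simp only [Function.comp_apply]
  rw [h2, vel_comp_real (hx.mdifferentiableAt (by simp)) (hr.differentiableAt (by simp)),
    ← christoffelBilin_apply, ← christoffelBilin_apply]
  simp only [map_smul, LinearMap.smul_apply]
  module

end Chart

section Action
variable {EG : Type*} [NormedAddCommGroup EG] [NormedSpace ℝ EG] [FiniteDimensional ℝ EG]
  {G : Type*} [TopologicalSpace G] [ChartedSpace EG G] [Group G] [LieGroup 𝓘(ℝ, EG) ∞ G]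
  {E : Type*} [NormedAddCommGroup E] [NormedSpace ℝ E] [FiniteDimensional ℝ E]
  {M : Type*} [TopologicalSpace M] [ChartedSpace E M] [IsManifold 𝓘(ℝ, E) ∞ M]
  [RiemannianBundle (fun p : M ↦ TangentSpace 𝓘(ℝ, E) p)]
  [IsContMDiffRiemannianBundle 𝓘(ℝ, E) ∞ E (fun p : M ↦ TangentSpace 𝓘(ℝ, E) p)]
  [MulAction G M]
  (h : IsCohomogeneityOne EG G E M) {γ : ℝ → M} (hγ : IsNormalGeodesic EG G E γ)
include h hγ

/-- The normal component of the acceleration of a curve in an orbit. -/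
theorem met_acc_smul {c : ℝ → G} (h0 : c 0 = 1) (hc : ContMDiffAt 𝓘(ℝ, ℝ) 𝓘(ℝ, EG) ∞ c 0) (u : ℝ) :
    met (γ u) (acc (fun σ ↦ c σ • γ u) 0) (vel E γ u) =
      -(1 / 2) * deriv (fun s ↦ met (γ s) (act EG G E (γ s) (vel EG c 0))
        (act EG G E (γ s) (vel EG c 0))) u := by
  have hγd : MDifferentiableAt 𝓘(ℝ, ℝ) 𝓘(ℝ, E) γ u :=
    hγ.geodesic.smooth.contMDiffAt.mdifferentiableAt (by simp)
  have hf := contMDiffAt_smul_slices h.smooth hc (hγ.geodesic.smooth u)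
  have hfv := first_variation (f := fun σ υ ↦ c σ • γ υ) hf
  -- Both velocities are images under the differential of `c σ`, one of an action field at `γ u` and
  -- the other of `γ'(u)`. The isometry reduces the claim to perpendicularity along `γ`.
  have hperp : (fun σ ↦ met (c σ • γ u) (vel E (fun σ' ↦ c σ' • γ u) σ)
      (vel E (fun υ ↦ c σ • γ υ) u)) =ᶠ[𝓝 0] fun _ ↦ 0 := by
    filter_upwards [(contMDiffAt_iff_contMDiffAt_nhds (n := 2) (by simp)).1 (hc.of_le two_le_infty)]
      with σ hσ
    obtain ⟨Y, hY⟩ := exists_dmap_smul_const h.smooth (c σ) (γ u) (vel EG c σ)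
    rw [vel_smul h.smooth (hσ.mdifferentiableAt (by simp)), hY]
    have h1 : vel E (fun υ ↦ c σ • γ υ) u = dmap E E (fun q : M ↦ c σ • q) (γ u) (vel E γ u) :=
      vel_comp ((contMDiff_smulLeft h.smooth (c σ)).mdifferentiable (by simp) _) hγd
    rw [h1, h.met_dmap, met_comm, hγ.met_vel_act]
  rw [hperp.deriv_eq, deriv_const] at hfv
  simp only [h0, one_smul, vel_smul_of_eq_one h.smooth (hc.mdifferentiableAt (by simp)) h0] at hfv
  change 0 = met (γ u) (acc (fun σ ↦ c σ • γ u) 0) (vel E γ u) + _ at hfv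
  linarith

omit h in
theorem IsNormalGeodesic.range_act_sup_span {t : ℝ} (ht : Module.finrank ℝ
      (LinearMap.range (act EG G E (γ t)).toLinearMap) + 1 = Module.finrank ℝ E) :
    LinearMap.range (act EG G E (γ t)).toLinearMap ⊔ Submodule.span ℝ {vel E γ t} = ⊤ := by
  refine Submodule.eq_top_of_finrank_eq ((Submodule.finrank_sup_span_singleton ?_).trans ht)
  rintro ⟨X, hX⟩
  have h1 := hγ.met_vel_act t X
  rw [show act EG G E (γ t) X = vel E γ t from hX, hγ.met_vel_vel] at h1
  exact one_ne_zero h1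

variable {EK : Type*} [NormedAddCommGroup EK] [NormedSpace ℝ EK] [FiniteDimensional ℝ EK]
  {K : Type*} [TopologicalSpace K] [ChartedSpace EK K] [Group K] [LieGroup 𝓘(ℝ, EK) ∞ K]
  {E' : Type*} [NormedAddCommGroup E'] [NormedSpace ℝ E'] [FiniteDimensional ℝ E']
  {N : Type*} [TopologicalSpace N] [ChartedSpace E' N] [IsManifold 𝓘(ℝ, E') ∞ N]
  [RiemannianBundle (fun p : N ↦ TangentSpace 𝓘(ℝ, E') p)]
  [IsContMDiffRiemannianBundle 𝓘(ℝ, E') ∞ E' (fun p : N ↦ TangentSpace 𝓘(ℝ, E') p)]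
  [MulAction K N]
  (h' : IsCohomogeneityOne EK K E' N) {δ : ℝ → N} (hδ : IsNormalGeodesic EK K E' δ)
  {A : G →* K} (hA : ContMDiff 𝓘(ℝ, EG) 𝓘(ℝ, EK) ∞ A) {r : ℝ → ℝ} {ψ : M → N} {t : ℝ}
  (hr : ContDiffAt ℝ ∞ r t) (hψ : ∀ᶠ s in 𝓝 t, ∀ g : G, ψ (g • γ s) = A g • δ (r s))
  (hψs : ContMDiffAt 𝓘(ℝ, E) 𝓘(ℝ, E') ∞ ψ (γ t)) (ht : IsPrincipal G (γ t))
include h' hδ hA hr hψ hψs ht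

/-- The differential of an equivariant map preserves the splitting into normal and tangential
directions. -/
theorem met_dmap_equivariant (w : E) :
    met (δ (r t)) (dmap E E' ψ (γ t) w) (vel E' δ (r t)) = deriv r t * met (γ t) w (vel E γ t) := by
  have hψd : MDifferentiableAt 𝓘(ℝ, E) 𝓘(ℝ, E') ψ (γ t) := hψs.mdifferentiableAt (by simp)
  obtain ⟨_, ⟨X, rfl⟩, _, hb, rfl⟩ := Submodule.mem_sup.1
    (hγ.range_act_sup_span (ht.finrank_range_act h) ▸ Submodule.mem_top : w ∈ _)
  obtain ⟨k, rfl⟩ := Submodule.mem_span_singleton.1 hb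
  -- Differentiating `ψ(g • γ(t)) = A(g) • δ(r(t))` in `g` at the identity.
  have h1 : dmap E E' ψ (γ t) (act EG G E (γ t) X) =
      act EK K E' (δ (r t)) (dmap EG EK A 1 X) := by
    have e1 := dmap_comp (E := EG) (E' := E) (ψ := fun g : G ↦ g • γ t) (χ := ψ) (p := 1)
      (by rw [one_smul]; exact hψd) ((contMDiff_smul_const h.smooth _).mdifferentiable (by simp) _) X
    have e2 := dmap_comp (E := EG) (E' := EK) (ψ := A) (χ := fun k : K ↦ k • δ (r t)) (p := 1)
      ((contMDiff_smul_const h'.smooth _).mdifferentiable (by simp) _) (hA.mdifferentiable (by simp) _) X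
    rw [map_one] at e2
    rw [one_smul] at e1
    refine e1.symm.trans (Eq.trans ?_ e2)
    simp only [Function.comp_def, hψ.self_of_nhds]
  -- Differentiating the same identity in the parameter of `γ`, with `g = 1`.
  have h2 : dmap E E' ψ (γ t) (vel E γ t) = deriv r t • vel E' δ (r t) := by
    rw [← vel_comp_real (hδ.geodesic.smooth.mdifferentiable (by simp) _)
      (hr.differentiableAt (by simp)), ← vel_comp hψd (hγ.geodesic.smooth.mdifferentiable (by simp) _)]
    have e : ψ ∘ γ =ᶠ[𝓝 t] δ ∘ r := hψ.mono fun s hs ↦ by simpa using hs 1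
    exact DFunLike.congr_fun (e.mfderiv_eq (I := 𝓘(ℝ, ℝ)) (I' := 𝓘(ℝ, E'))) (1 : ℝ)
  change met (δ (r t)) (dmap E E' ψ (γ t) (act EG G E (γ t) X + k • vel E γ t)) _ =
    deriv r t * met (γ t) (act EG G E (γ t) X + k • vel E γ t) _
  simp only [map_add, map_smul, h1, h2, add_apply, smul_apply, smul_eq_mul,
    met_comm _ (act EK K E' _ _), met_comm _ (act EG G E _ _), hδ.met_vel_act, hγ.met_vel_act,
    hδ.met_vel_vel, hγ.met_vel_vel]
  ring

/-- A curve `c(σ) • γ(t)` and its image both lie in orbits, so `met_acc_smul` computes both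
accelerations in `acc_comp`. The factor `r'` comes from applying `dψ` to the first. -/
theorem met_hess_act (X : EG) :
    met (δ (r t)) (hess E E' ψ (γ t) (act EG G E (γ t) X) (act EG G E (γ t) X)) (vel E' δ (r t)) =
      1 / 2 * deriv r t * deriv (fun s ↦ met (γ s) (act EG G E (γ s) X) (act EG G E (γ s) X)) t
      - 1 / 2 * deriv (fun s ↦ met (δ s) (act EK K E' (δ s) (dmap EG EK A 1 X))
        (act EK K E' (δ s) (dmap EG EK A 1 X))) (r t) := by
  obtain ⟨c, h0, hc, rfl⟩ := exists_curve_vel_eq (1 : G) X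
  have hcd : MDifferentiableAt 𝓘(ℝ, ℝ) 𝓘(ℝ, EG) c 0 := hc.mdifferentiableAt (by simp)
  have hv : vel EK (fun σ ↦ A (c σ)) 0 = dmap EG EK A 1 (vel EG c 0) := by
    have := vel_comp (ψ := A) (hA.mdifferentiable (by simp) (c 0)) hcd
    rwa [h0] at this
  have hM := met_acc_smul h hγ h0 hc t
  have hN := met_acc_smul h' hδ (c := fun σ ↦ A (c σ)) (by simp [h0]) (hA.contMDiffAt.comp 0 hc) (r t)
  rw [hv] at hN
  have hx : ContMDiffAt 𝓘(ℝ, ℝ) 𝓘(ℝ, E) 2 (fun σ ↦ c σ • γ t) 0 :=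
    ((contMDiff_smul_const h.smooth (γ t)).contMDiffAt.comp 0 hc).of_le two_le_infty
  have hacc := acc_comp (ψ := ψ) (x := fun σ ↦ c σ • γ t) (t := 0)
    (by rw [h0, one_smul]; exact hψs.of_le two_le_infty) hx
  simp only [Function.comp_def, hψ.self_of_nhds, vel_smul_of_eq_one h.smooth hcd h0] at hacc
  simp only [h0, one_smul] at hacc
  have h1 := congrArg (fun w ↦ met (δ (r t)) w (vel E' δ (r t))) hacc
  simp only [map_add, add_apply,
    met_dmap_equivariant h hγ h' hδ hA hr hψ hψs ht] at h1
  rw [hM] at h1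
  have h2 := h1.symm.trans hN
  linarith

omit h h' hA ht in
-- Compare the two expressions for the acceleration of `ψ ∘ γ = δ ∘ r`: since `γ` and `δ` are
-- geodesics, only `∇dψ(γ', γ')` and `r'' δ'` remain.
theorem met_hess_vel :
    met (δ (r t)) (hess E E' ψ (γ t) (vel E γ t) (vel E γ t)) (vel E' δ (r t)) =
      deriv (deriv r) t := by
  have hr2 : ContDiffAt ℝ 2 r t := hr.of_le two_le_infty
  have hx : ContMDiffAt 𝓘(ℝ, ℝ) 𝓘(ℝ, E) 2 γ t := hγ.geodesic.smooth.contMDiffAt.of_le two_le_infty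
  have hy : ContMDiffAt 𝓘(ℝ, ℝ) 𝓘(ℝ, E') 2 δ (r t) :=
    hδ.geodesic.smooth.contMDiffAt.of_le two_le_infty
  have hacc := acc_comp (ψ := ψ) (hψs.of_le two_le_infty) hx
  have h0 : (acc γ t : E) = 0 := hγ.geodesic.acceleration_eq_zero t
  have h0' : (acc δ (r t) : E') = 0 := hδ.geodesic.acceleration_eq_zero (r t)
  have e : δ ∘ r =ᶠ[𝓝 t] ψ ∘ γ := hψ.mono fun s hs ↦ by simpa using (hs 1).symm
  have h1 := (acc_congr e (hy.comp t hr2.contMDiffAt)).symm.trans (acc_comp_real hy hr2)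
  rw [h0, map_zero, add_zero] at hacc
  rw [h0', smul_zero, zero_add] at h1
  have h2 := hacc.symm.trans h1
  rw [h2, map_smul, smul_apply, hδ.met_vel_vel, smul_eq_mul, mul_one]

/-- The normal component of the tension field of an equivariant map. -/
theorem met_tension {ι : Type*} [Fintype ι] [DecidableEq ι] {e : ι → EG}
    (he : ∀ i j, met (γ t) (act EG G E (γ t) (e i)) (act EG G E (γ t) (e j)) = if i = j then 1 else 0)
    (hspan : LinearMap.range (act EG G E (γ t)).toLinearMap ≤
      Submodule.span ℝ (Set.range fun i ↦ act EG G E (γ t) (e i))) :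
    met (E := E') (δ (r t)) (tension E E' ψ (γ t)) (vel E' δ (r t)) =
      deriv (deriv r) t + 1 / 2 * deriv r t *
        ∑ i, deriv (fun s ↦ met (γ s) (act EG G E (γ s) (e i)) (act EG G E (γ s) (e i))) t
      - 1 / 2 * ∑ i, deriv (fun s ↦ met (δ s) (act EK K E' (δ s) (dmap EG EK A 1 (e i)))
        (act EK K E' (δ s) (dmap EG EK A 1 (e i)))) (r t) := by
  -- The adapted orthonormal frame: `none` is the normal direction, `some i` the action fields
  -- tangent to the orbit.
  let v : Option ι → TangentSpace 𝓘(ℝ, E) (γ t) :=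
    fun i ↦ i.elim (vel E γ t) fun i ↦ act EG G E (γ t) (e i)
  have hon : Orthonormal ℝ v := by
    rw [orthonormal_iff_ite]
    rintro (_ | i) (_ | j)
    · exact hγ.met_vel_vel t
    · exact hγ.met_vel_act t (e j)
    · exact (met_comm _ _ _).trans (hγ.met_vel_act t (e i))
    · refine (he i j).trans ?_
      simp only [Option.some.injEq]
  have htop : @Eq (Submodule ℝ E) (Submodule.span ℝ (Set.range v)) ⊤ := by
    refine top_unique ((hγ.range_act_sup_span (ht.finrank_range_act h)).symm.le.trans ?_)
    refine sup_le (hspan.trans (Submodule.span_mono ?_)) (Submodule.span_mono ?_)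
    · rintro _ ⟨i, rfl⟩
      exact ⟨some i, rfl⟩
    · rintro _ rfl
      exact ⟨none, rfl⟩
  have h1 := tension_eq_sum E E' (hψs.of_le two_le_infty)
    (OrthonormalBasis.mk hon (show ⊤ ≤ Submodule.span ℝ (Set.range v) from htop.symm.le))
  rw [Fintype.sum_option] at h1
  simp only [OrthonormalBasis.coe_mk] at h1
  change (tension E E' ψ (γ t) : E') = hess E E' ψ (γ t) (vel E γ t) (vel E γ t) +
    ∑ i, hess E E' ψ (γ t) (act EG G E (γ t) (e i)) (act EG G E (γ t) (e i)) at h1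
  refine (congrArg (fun w ↦ met (δ (r t)) w (vel E' δ (r t))) h1).trans ?_
  simp only [map_add, map_sum, add_apply, sum_apply, met_hess_vel hγ hδ hr hψ hψs,
    met_hess_act h hγ h' hδ hA hr hψ hψs ht, Finset.sum_sub_distrib, ← Finset.mul_sum]
  ring

end Action

end CohomOne
end

/-! ### The formula in terms of metric endomorphisms. -/

theorem mainTheorem4
    -- the compact Lie group `G`, acting with cohomogeneity one on `M`
    {EG : Type*} [NormedAddCommGroup EG] [NormedSpace ℝ EG] [FiniteDimensional ℝ EG]
    {G : Type*} [TopologicalSpace G] [ChartedSpace EG G] [Group G] [LieGroup 𝓘(ℝ, EG) ∞ G]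
    [CompactSpace G] [T2Space G]
    {EM : Type*} [NormedAddCommGroup EM] [NormedSpace ℝ EM] [FiniteDimensional ℝ EM]
    {M : Type*} [TopologicalSpace M] [ChartedSpace EM M] [IsManifold 𝓘(ℝ, EM) ∞ M]
    [T2Space M] [SigmaCompactSpace M] [ConnectedSpace M]
    [RiemannianBundle (fun p : M ↦ TangentSpace 𝓘(ℝ, EM) p)]
    [IsContMDiffRiemannianBundle 𝓘(ℝ, EM) ∞ EM (fun p : M ↦ TangentSpace 𝓘(ℝ, EM) p)]
    [MulAction G M] (hM : CohomOne.IsCohomogeneityOne EG G EM M)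
    -- the compact Lie group `K`, acting with cohomogeneity one on `N`
    {EK : Type*} [NormedAddCommGroup EK] [NormedSpace ℝ EK] [FiniteDimensional ℝ EK]
    {K : Type*} [TopologicalSpace K] [ChartedSpace EK K] [Group K] [LieGroup 𝓘(ℝ, EK) ∞ K]
    [CompactSpace K] [T2Space K]
    {EN : Type*} [NormedAddCommGroup EN] [NormedSpace ℝ EN] [FiniteDimensional ℝ EN]
    {N : Type*} [TopologicalSpace N] [ChartedSpace EN N] [IsManifold 𝓘(ℝ, EN) ∞ N]
    [T2Space N] [SigmaCompactSpace N] [ConnectedSpace N]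
    [RiemannianBundle (fun p : N ↦ TangentSpace 𝓘(ℝ, EN) p)]
    [IsContMDiffRiemannianBundle 𝓘(ℝ, EN) ∞ EN (fun p : N ↦ TangentSpace 𝓘(ℝ, EN) p)]
    [MulAction K N] (hN : CohomOne.IsCohomogeneityOne EK K EN N)
    -- biinvariant metrics, normal geodesics `γ` on `M` and `δ` on `N`
    (Q : CohomOne.BiinvariantMetric EG G) (Q' : CohomOne.BiinvariantMetric EK K)
    (γ : ℝ → M) (hγ : CohomOne.IsNormalGeodesic EG G EM γ)
    (δ : ℝ → N) (hδ : CohomOne.IsNormalGeodesic EK K EN δ)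
    -- the isotropy groups `H` and `H'` of the regular points of `γ` and of `δ`
    (H : Subgroup G) (hH : ∃ s, CohomOne.IsPrincipal G (γ s) ∧ H = MulAction.stabilizer G (γ s))
    (H' : Subgroup K) (hH' : ∃ s, CohomOne.IsPrincipal K (δ s) ∧ H' = MulAction.stabilizer K (δ s))
    -- the equivariant map `ψ`
    (A : G →* K) (hA : ContMDiff 𝓘(ℝ, EG) 𝓘(ℝ, EK) ∞ A)
    (J : Set ℝ) (hJ : IsOpen J) (hJreg : ∀ s ∈ J, CohomOne.IsPrincipal G (γ s))
    (r : ℝ → ℝ) (hr : ContDiffOn ℝ ∞ r J)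
    (ψ : M → N) (hψ : ∀ (g : G), ∀ s ∈ J, ψ (g • γ s) = A g • δ (r s))
    (hψsmooth : ∀ (g : G), ∀ s ∈ J, ContMDiffAt 𝓘(ℝ, EM) 𝓘(ℝ, EN) ∞ ψ (g • γ s))
    -- the time, and the orthonormal bases of the tangent spaces of the orbits; `hψt` repeats `hψ`
    -- for `g = 1`, and serves to compare tangent vectors at `ψ (γ t)` and at `δ (r t)`
    (t : ℝ) (ht : t ∈ J) (htN : CohomOne.IsPrincipal K (δ t)) (hψt : ψ (γ t) = δ (r t))
    (n m : ℕ) (e : Fin n → GroupLieAlgebra 𝓘(ℝ, EG) G)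
    (he : Orthonormal ℝ (fun μ ↦ CohomOne.actionField EG EM (γ t) (e μ)))
    (hespan : Submodule.span ℝ (Set.range fun μ ↦
        CohomOne.actionField EG EM (γ t) (e μ))
      = CohomOne.orbitTangent EG G EM (γ t))
    (f : Module.Basis (Fin m) ℝ (CohomOne.complement Q' H'))
    (hf : Orthonormal ℝ (fun i ↦ CohomOne.actionField EK EN (δ t) (f i : GroupLieAlgebra 𝓘(ℝ, EK) K))) :
    let P := CohomOne.metricEndo EM Q (CohomOne.complement Q H) γ
    let P' := CohomOne.metricEndo EN Q' (CohomOne.complement Q' H') δ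
    let c : Fin n → Fin m → ℝ := fun μ i ↦
      inner ℝ (CohomOne.actionField EK EN (δ t) (CohomOne.lieMap A (e μ)))
        (CohomOne.actionField EK EN (δ t) (f i : GroupLieAlgebra 𝓘(ℝ, EK) K))
    let R : Matrix (Fin m) (Fin m) ℝ :=
      LinearMap.toMatrix f f (Ring.inverse (P' t) * CohomOne.endoDeriv P' (r t))
    inner ℝ (CohomOne.tangentCast hψt (CohomOne.tension EM EN ψ (γ t))) (CohomOne.velocity EN δ (r t))
      = deriv (deriv r) t
        + 1 / 2 * deriv r t
          * LinearMap.trace ℝ _ (Ring.inverse (P t) * CohomOne.endoDeriv P t)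
        - 1 / 2 * ∑ μ, ∑ i, ∑ j, c μ i * c μ j * R i j := by
  intro P P' c R
  obtain ⟨s, hs, rfl⟩ := hH
  obtain ⟨s', hs', rfl⟩ := hH'
  have hrt : ContDiffAt ℝ ∞ r t := hr.contDiffAt (hJ.mem_nhds ht)
  have hψ' : ∀ᶠ s in 𝓝 t, ∀ g : G, ψ (g • γ s) = A g • δ (r s) :=
    Filter.mem_of_superset (hJ.mem_nhds ht) fun s hs g ↦ hψ g s hs
  have hψs : ContMDiffAt 𝓘(ℝ, EM) 𝓘(ℝ, EN) ∞ ψ (γ t) := by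
    simpa only [one_smul] using hψsmooth 1 t ht
  have htp := hJreg t ht
  have he' (i j) : CohomOne.met (γ t) (CohomOne.act EG G EM (γ t) (e i))
      (CohomOne.act EG G EM (γ t) (e j)) = if i = j then 1 else 0 := by
    rw [← orthonormal_iff_ite.1 he i j, CohomOne.inner_eq_met]
    exact (congrArg₂ (fun a b ↦ CohomOne.met (E := EM) (γ t) a b)
      (CohomOne.actionField_eq_act _ _) (CohomOne.actionField_eq_act _ _)).symm
  have hf' (i j) : CohomOne.met (δ t)
      (CohomOne.act EK K EN (δ t) (f i : GroupLieAlgebra 𝓘(ℝ, EK) K))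
      (CohomOne.act EK K EN (δ t) (f j : GroupLieAlgebra 𝓘(ℝ, EK) K)) = if i = j then 1 else 0 := by
    rw [← orthonormal_iff_ite.1 hf i j, CohomOne.inner_eq_met]
    exact (congrArg₂ (fun a b ↦ CohomOne.met (E := EN) (δ t) a b)
      (CohomOne.actionField_eq_act _ _) (CohomOne.actionField_eq_act _ _)).symm
  have hfun : (fun μ ↦ (CohomOne.actionField EG EM (γ t) (e μ) : EM)) =
      fun μ ↦ CohomOne.act EG G EM (γ t) (e μ) :=
    funext fun μ ↦ CohomOne.actionField_eq_act _ _
  have hspan : @Eq (Submodule ℝ EM)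
      (Submodule.span ℝ (Set.range fun μ ↦ CohomOne.act EG G EM (γ t) (e μ)))
      (LinearMap.range (CohomOne.act EG G EM (γ t)).toLinearMap) :=
    (congrArg (fun v : Fin n → EM ↦ Submodule.span ℝ (Set.range v)) hfun).symm.trans
      (hespan.trans (CohomOne.orbitTangent_eq_range (γ t)))
  have hA1 (X : EG) : (CohomOne.lieMap A X : EK) = CohomOne.dmap EG EK A 1 X :=
    CohomOne.tangentCast_apply (map_one A) (CohomOne.dmap EG EK A 1 X)
  have hc (μ i) : c μ i = CohomOne.met (δ t)
      (CohomOne.act EK K EN (δ t) (CohomOne.dmap EG EK A 1 (e μ)))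
      (CohomOne.act EK K EN (δ t) (f i : GroupLieAlgebra 𝓘(ℝ, EK) K)) :=
    congrArg₂ (fun a b ↦ CohomOne.met (E := EN) (δ t) a b)
      ((CohomOne.actionField_eq_act _ _).trans (congrArg _ (hA1 (e μ))))
      (CohomOne.actionField_eq_act _ _)
  -- The coefficients `c` are taken at `δ t`, whereas the derivative on the right is at `r t`; the
  -- factor `(P' t)⁻¹` in `R` accounts for the difference.
  have hsum (μ) : ∑ i, ∑ j, c μ i * c μ j * R i j =
      deriv (fun s ↦ CohomOne.met (δ s)
        (CohomOne.act EK K EN (δ s) (CohomOne.dmap EG EK A 1 (e μ)))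
        (CohomOne.act EK K EN (δ s) (CohomOne.dmap EG EK A 1 (e μ)))) (r t) := by
    simp only [hc]
    exact CohomOne.sum_mul_toMatrix_metricEndo hN hδ htN hs' Q' (r t) f hf'
      (CohomOne.dmap EG EK A 1 (e μ))
  have htrace : LinearMap.trace ℝ _ (Ring.inverse (P t) * CohomOne.endoDeriv P t) =
      ∑ μ, deriv (fun s ↦ CohomOne.met (γ s) (CohomOne.act EG G EM (γ s) (e μ))
        (CohomOne.act EG G EM (γ s) (e μ))) t :=
    CohomOne.trace_metricEndo hM hγ htp hs Q t he' fun X ↦ by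
      obtain ⟨a, ha⟩ := Submodule.mem_span_range_iff_exists_fun ℝ |>.1
        (hspan.ge ⟨X, rfl⟩)
      exact ⟨a, ha.symm⟩
  rw [htrace]
  simp only [hsum]
  exact (congrArg (fun w : EN ↦ CohomOne.met (E := EN) (δ (r t)) w (CohomOne.vel EN δ (r t)))
    (CohomOne.tangentCast_apply (E := EN) hψt (CohomOne.tension EM EN ψ (γ t)))).trans
    (CohomOne.met_tension hM hγ hN hδ hA hrt hψ' hψs htp he' hspan.ge)
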